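/- Let $\mathbb{R}_+=(0,\infty)$ and let $\mathbb{E}$ be a rearrangement invariant Banach function space over $(\mathbb{R}_+,\mathrm{d}t)$ (in the sense of Bennett and Sharpley). For $t>0$ let $h_{\mathbb{E}}(t)$ be the operator norm on $\mathbb{E}$ of the dilation $(D_tf)(s)=f(s/t)$, and suppose that the Boyd indices $$p_{\mathbb{E}}=\sup_{t>1}\frac{\log t}{\log h_{\mathbb{E}}(t)},\qquad q_{\mathbb{E}}=\inf_{0<t<1}\frac{\log t}{\log h_{\mathbb{E}}(t)}$$ (a quotient with denominator $0$ being read as $\infty$) both lie in $(1,\infty)$. A weight on $\mathbb{R}_+$ is a measurable function $w:\mathbb{R}_+\to[0,\infty)$ with $w>0$ almost everywhere. For $1<p<\infty$ and $p'=p/(p-1)$, write $w\in A_p^+(\mathbb{R}_+)$ if $$\sup_{0\le a<b<c}\frac{1}{(c-a)^p}\int_a^b w\,\mathrm{d}t\left(\int_b^c w^{1-p'}\,\mathrm{d}t\right)^{p-1}<\infty ,$$ and $w\in A_p^-(\mathbb{R}_+)$ if $$\sup_{0\le a<b<c}\frac{1}{(c-a)^p}\int_b^c w\,\mathrm{d}t\left(\int_a^b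 w^{1-p'}\,\mathrm{d}t\right)^{p-1}<\infty .$$ Let $\mathbb{E}_w$ be the space of measurable functions $f$ on $\mathbb{R}_+$ with $\|f\|_{\mathbb{E}_w}:=\|f_w^*\|_{\mathbb{E}}<\infty$, where $f_w^*$ is the decreasing rearrangement of $|f|$ with respect to the measure $w\,\mathrm{d}t$. For measurable $f$ on $\mathbb{R}_+$, extended by $0$ to $\mathbb{R}$, and $t>0$ put $$M_+^+f(t)=\sup_{h>0}\frac1h\int_t^{t+h}|f|\,\mathrm{d}s,\qquad M_+^-f(t)=\sup_{h>0}\frac1h\int_{t-h}^{t}|f|\,\mathrm{d}s .$$ Then for every $w\in A^+_{p_{\mathbb{E}}}(\mathbb{R}_+)$ the operator $M_+^+$ is bounded on $\mathbb{E}_w$, and for every $w\in A^-_{p_{\mathbb{E}}}(\mathbb{R}_+)$ the operator $M_+^-$ is bounded on $\mathbb{E}_w$; that is, there is a finite constant $C$ such that $M_+^\pm f\in\mathbb{E}_w$ and $\|M_+^\pm f\|_{\mathbb{E}_w}\le C\|f\|_{\mathbb{E}_w}$ for all $f\in\mathbb{E}_w$. -/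

import Mathlib

open MeasureTheory Set
open scoped ENNReal NNReal

namespace HalfLine

/-- Lebesgue measure on the half-line `(0, ∞)`, regarded as a measure on `ℝ`. -/
noncomputable def vol : Measure ℝ := volume.restrict (Ioi 0)

/-- A rearrangement invariant Banach function norm over `((0, ∞), dt)`: a functional on the
nonnegative (`[0, ∞]`-valued) measurable functions with the usual axioms of Bennett and Sharpley.
The corresponding Banach function space consists of the measurable `f` with `ρ |f| < ∞`. -/
structure RIBanachFunctionNorm where
  /-- the norm on nonnegative functions -/
  ρ : (ℝ → ℝ≥0∞) → ℝ≥0∞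
  eq_zero_iff : ∀ f, Measurable f → (ρ f = 0 ↔ f =ᵐ[vol] 0)
  smul : ∀ (a : ℝ≥0) f, Measurable f → ρ (fun s => a * f s) = a * ρ f
  add_le : ∀ f g, Measurable f → Measurable g → ρ (fun s => f s + g s) ≤ ρ f + ρ g
  mono : ∀ f g, Measurable f → Measurable g → f ≤ᵐ[vol] g → ρ f ≤ ρ g
  fatou : ∀ f : ℕ → ℝ → ℝ≥0∞, (∀ n, Measurable (f n)) → Monotone f →
    ρ (fun s => ⨆ n, f n s) = ⨆ n, ρ (f n)
  indicator_lt_top : ∀ A, MeasurableSet A → vol A < ∞ → ρ (A.indicator 1) < ∞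
  lintegral_le : ∀ A, MeasurableSet A → vol A < ∞ →
    ∃ C : ℝ≥0, ∀ f, Measurable f → ∫⁻ s in A, f s ∂vol ≤ C * ρ f
  rearrangement_invariant : ∀ f g, Measurable f → Measurable g →
    (∀ l : ℝ≥0∞, vol {s | l < f s} = vol {s | l < g s}) → ρ f = ρ g

/-- `h_E(t)`, the operator norm on `E` of the dilation operator `(D_t f)(s) = f (s / t)`. -/
noncomputable def RIBanachFunctionNorm.dilationNorm (E : RIBanachFunctionNorm) (t : ℝ) : ℝ≥0∞ :=
  ⨆ (f : ℝ → ℝ≥0∞) (_ : Measurable f) (_ : E.ρ f ≤ 1), E.ρ (fun s => f (s / t))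

/-- The lower Boyd index `sup_{t > 1} log t / log h_E(t)`, with values in `[0, ∞]`.
Here `log t > 0`, `log h_E(t) ≥ 0`, and the quotient is `∞` if `log h_E(t) = 0`. -/
noncomputable def RIBanachFunctionNorm.lowerBoyd (E : RIBanachFunctionNorm) : ℝ≥0∞ :=
  ⨆ t ∈ Ioi (1 : ℝ), ENNReal.ofReal (Real.log t) / (ENNReal.log (E.dilationNorm t)).toENNReal

/-- The upper Boyd index `inf_{0 < t < 1} log t / log h_E(t)`, with values in `[0, ∞]`.
Here `log t < 0`, `log h_E(t) ≤ 0`, and the quotient (written with both signs changed)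
is `∞` if `log h_E(t) = 0`. -/
noncomputable def RIBanachFunctionNorm.upperBoyd (E : RIBanachFunctionNorm) : ℝ≥0∞ :=
  ⨅ t ∈ Ioo (0 : ℝ) 1,
    ENNReal.ofReal (-Real.log t) / (-ENNReal.log (E.dilationNorm t)).toENNReal

/-- The decreasing rearrangement of `f` with respect to `μ`. -/
noncomputable def rearrangement (μ : Measure ℝ) (f : ℝ → ℝ≥0∞) (t : ℝ) : ℝ≥0∞ :=
  sInf {l : ℝ≥0∞ | μ {s | l < f s} ≤ ENNReal.ofReal t}

/-- The measure `w dt` on `(0, ∞)`. -/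
noncomputable def weightMeasure (w : ℝ → ℝ) : Measure ℝ :=
  vol.withDensity (fun t => ENNReal.ofReal (w t))

/-- The norm `ρ_w(f) = ‖f*_w‖_E`. -/
noncomputable def RIBanachFunctionNorm.weightedNorm (E : RIBanachFunctionNorm) (w : ℝ → ℝ)
    (f : ℝ → ℝ≥0∞) : ℝ≥0∞ :=
  E.ρ (rearrangement (weightMeasure w) f)

/-- Membership of a nonnegative function in `E_w`; a real function `f` belongs to `E_w`
if and only if `|f|` does. -/
def RIBanachFunctionNorm.MemWeighted (E : RIBanachFunctionNorm) (w : ℝ → ℝ)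
    (f : ℝ → ℝ≥0∞) : Prop :=
  AEMeasurable f vol ∧ E.weightedNorm w f < ∞

/-- A weight on the half-line: measurable, real valued, positive almost everywhere. -/
def IsWeight (w : ℝ → ℝ) : Prop :=
  AEMeasurable w vol ∧ ∀ᵐ t ∂vol, 0 < w t

/-- The constant of Sawyer's condition `A_p^+` on the half-line. -/
noncomputable def apPlusConst (p : ℝ) (w : ℝ → ℝ) : ℝ≥0∞ :=
  ⨆ (a : ℝ) (b : ℝ) (c : ℝ) (_ : 0 ≤ a) (_ : a < b) (_ : b < c),
    (∫⁻ t in Ioo a b, ENNReal.ofReal (w t)) *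
      (∫⁻ t in Ioo b c, ENNReal.ofReal (w t ^ (1 - p / (p - 1)))) ^ (p - 1) /
        ENNReal.ofReal ((c - a) ^ p)

/-- The constant of Sawyer's condition `A_p^-` on the half-line. -/
noncomputable def apMinusConst (p : ℝ) (w : ℝ → ℝ) : ℝ≥0∞ :=
  ⨆ (a : ℝ) (b : ℝ) (c : ℝ) (_ : 0 ≤ a) (_ : a < b) (_ : b < c),
    (∫⁻ t in Ioo b c, ENNReal.ofReal (w t)) *
      (∫⁻ t in Ioo a b, ENNReal.ofReal (w t ^ (1 - p / (p - 1)))) ^ (p - 1) /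
        ENNReal.ofReal ((c - a) ^ p)

/-- `w ∈ A_p^+` on the half-line, `1 < p < ∞`. -/
def MemApPlus (p : ℝ) (w : ℝ → ℝ) : Prop := IsWeight w ∧ apPlusConst p w < ∞

/-- `w ∈ A_p^-` on the half-line, `1 < p < ∞`. -/
def MemApMinus (p : ℝ) (w : ℝ → ℝ) : Prop := IsWeight w ∧ apMinusConst p w < ∞

/-- The one-sided maximal function `M^+ f` on the line. -/
noncomputable def maxPlus (f : ℝ → ℝ) (t : ℝ) : ℝ≥0∞ :=
  ⨆ h ∈ Ioi (0 : ℝ), (∫⁻ s in Ioo t (t + h), ‖f s‖ₑ) / ENNReal.ofReal h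

/-- The one-sided maximal function `M^- f` on the line. -/
noncomputable def maxMinus (f : ℝ → ℝ) (t : ℝ) : ℝ≥0∞ :=
  ⨆ h ∈ Ioi (0 : ℝ), (∫⁻ s in Ioo (t - h) t, ‖f s‖ₑ) / ENNReal.ofReal h

/-- `M^+_+ f`: extend `f` from the half-line by zero, apply `M^+`, restrict to the half-line. -/
noncomputable def halfMaxPlus (f : ℝ → ℝ) : ℝ → ℝ≥0∞ :=
  (Ioi 0).indicator (maxPlus ((Ioi 0).indicator f))

/-- `M^-_+ f`: extend `f` from the half-line by zero, apply `M^-`, restrict to the half-line. -/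
noncomputable def halfMaxMinus (f : ℝ → ℝ) : ℝ → ℝ≥0∞ :=
  (Ioi 0).indicator (maxMinus ((Ioi 0).indicator f))

/-- `T` maps `E_w` into `E_w` and `‖T f‖ ≤ C ‖f‖` there, with one finite constant `C`. -/
def RIBanachFunctionNorm.BoundedOnWeighted (E : RIBanachFunctionNorm) (w : ℝ → ℝ)
    (T : (ℝ → ℝ) → ℝ → ℝ≥0∞) : Prop :=
  ∃ C : ℝ≥0, ∀ f : ℝ → ℝ, AEMeasurable f vol → E.MemWeighted w (fun s => ‖f s‖ₑ) →
    E.MemWeighted w (T f) ∧ E.weightedNorm w (T f) ≤ C * E.weightedNorm w (fun s => ‖f s‖ₑ)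

end HalfLine

namespace HalfLine

/-! The proof has two halves: a weak type `(r, r)` inequality with some `r` strictly below the lower
Boyd index `p`, and an interpolation argument that turns it into a bound for rearrangements.

For the weak type, write `s` for the dual weight, so that `w * s ^ (p - 1) = 1`. The set where a
right maximal function exceeds `l` splits, by the rising sun lemma `measure_riseSet_le`, into
intervals on which every mean up to the right end point is at least `l`. Cutting such an interval
into pieces of geometrically decreasing mass and testing the one-sided condition on neighbouring
pieces gives the inequality with exponent `p` (`weakType`). The exponent is then lowered. On a
rising sun interval, `s` is at least `β * l` on a quarter of the length (`goodLambda_component`).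
Integrating this over the levels gives a one-sided reverse Hölder inequality (`reverseHolder`).
Combined with `weakType` applied to `s` itself, it shows that `w` satisfies the condition with
exponent `1 + (p - 1) / (1 + δ) < p` (`OneSidedAp.improve`). Reflection gives averages to the left,
and exhausting the half-line by compact intervals gives the global statement.

For the interpolation, `M` is bounded on `L^∞` in the truncated form `M g ≤ a + M (g 1_{g > a})`.
Taking `a = g*(t)` and slicing `g` at the levels `g*(t / τ ^ n)` bounds `(M g)*(t)` by a series of
dilates of `g*` with ratio `τ ^ (-1 / r)` (`rearrangement_le_of_weakType`). Since `r < p`, some `τ >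
1` has dilation norm below `τ ^ (1 / r)`, so the norms form a convergent geometric series
(`exists_bound_of_weakType`). -/

/-! ### The rising sun lemma -/

/-- The distribution function of a finite measure without atoms. -/
theorem exists_continuous_measure_Ioo (m : Measure ℝ) [IsFiniteMeasure m] [NullSingletonClass m] :
    ∃ F : ℝ → ℝ, Continuous F ∧
      ∀ x y, x ≤ y → F x ≤ F y ∧ m (Ioo x y) = ENNReal.ofReal (F y - F x) := by
  have hint : ∀ a b, IntervalIntegrable (fun _ : ℝ => (1 : ℝ)) m a b := fun a b =>
    intervalIntegrable_const
  refine ⟨fun b => ∫ _ in (0 : ℝ)..b, (1 : ℝ) ∂m, intervalIntegral.continuous_primitive hint 0,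
    fun x y hxy => ?_⟩
  have h : (∫ _ in (0 : ℝ)..y, (1 : ℝ) ∂m) - ∫ _ in (0 : ℝ)..x, (1 : ℝ) ∂m = m.real (Ioo x y) := by
    rw [intervalIntegral.integral_interval_sub_left (hint _ _) (hint _ _),
      intervalIntegral.integral_of_le hxy]
    simp [Measure.real, Ioo_ae_eq_Ioc.measure_eq]
  constructor
  · have := measureReal_nonneg (μ := m) (s := Ioo x y)
    linarith
  · rw [h, Measure.real, ENNReal.ofReal_toReal (measure_ne_top _ _)]

/-- The points of `(A, B)` at which the right maximal function of `m`, restricted to `(A, B)`,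
exceeds `l`. -/
def riseSet (m : Measure ℝ) (l A B : ℝ) : Set ℝ :=
  {x | x ∈ Ioo A B ∧ ∃ y, x < y ∧ y ≤ B ∧ ENNReal.ofReal (l * (y - x)) < m (Ioo x y)}

theorem riseSet_subset (m : Measure ℝ) (l A B : ℝ) : riseSet m l A B ⊆ Ioo A B := fun _ h => h.1

/-- A bounded open set is a countable disjoint union of open intervals whose end points do not
belong to it. -/
theorem exists_components {O : Set ℝ} (hO : IsOpen O) {A B : ℝ} (hOs : O ⊆ Ioo A B) :
    ∃ I : Set (Set ℝ), I.Countable ∧ I.PairwiseDisjoint id ∧ ⋃₀ I = O ∧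
      ∀ s ∈ I, ∃ a b, A ≤ a ∧ a < b ∧ b ≤ B ∧ s = Ioo a b ∧ a ∉ O ∧ b ∉ O := by
  refine ⟨(fun x => connectedComponentIn O x) '' O, ?_, ?_, ?_, ?_⟩
  · refine PairwiseDisjoint.countable_of_isOpen (s := id) ?_ ?_ ?_
    · rintro _ ⟨x, hx, rfl⟩ _ ⟨y, hy, rfl⟩ hne
      rw [Function.onFun, Set.disjoint_left]
      intro z hz hz'
      exact hne ((connectedComponentIn_eq hz).trans (connectedComponentIn_eq hz').symm)
    · rintro _ ⟨x, hx, rfl⟩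
      exact hO.connectedComponentIn
    · rintro _ ⟨x, hx, rfl⟩
      exact ⟨x, mem_connectedComponentIn hx⟩
  · rintro _ ⟨x, hx, rfl⟩ _ ⟨y, hy, rfl⟩ hne
    rw [Function.onFun, Set.disjoint_left]
    intro z hz hz'
    exact hne ((connectedComponentIn_eq hz).trans (connectedComponentIn_eq hz').symm)
  · apply subset_antisymm
    · rintro z ⟨_, ⟨x, hx, rfl⟩, hz⟩
      exact connectedComponentIn_subset _ _ hz
    · exact fun x hx => ⟨_, ⟨x, hx, rfl⟩, mem_connectedComponentIn hx⟩
  · rintro _ ⟨x, hx, rfl⟩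
    set s := connectedComponentIn O x with hs
    have hsO : s ⊆ O := connectedComponentIn_subset _ _
    have hso : IsOpen s := hO.connectedComponentIn
    have hxs : x ∈ s := mem_connectedComponentIn hx
    have hsc : IsPreconnected s := isPreconnected_connectedComponentIn
    have hbb : BddBelow s := ⟨A, fun z hz => (hOs (hsO hz)).1.le⟩
    have hba : BddAbove s := ⟨B, fun z hz => (hOs (hsO hz)).2.le⟩
    -- The component of such a `c` is open and meets `s`, hence equals `s`. The infimum and supremum
    -- of the open set `s` are not in `s`, so they cannot lie in `O` either.
    have hclosed : ∀ c ∈ closure s, c ∈ O → c ∈ s := by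
      intro c hc hcO
      have hcs : c ∈ connectedComponentIn O c := mem_connectedComponentIn hcO
      obtain ⟨z, hz, hz'⟩ := mem_closure_iff.1 hc _ hO.connectedComponentIn hcs
      rw [hs, connectedComponentIn_eq hz', ← connectedComponentIn_eq hz]
      exact hcs
    have hinf : sInf s ∉ s := by
      intro h
      obtain ⟨u, hu, hus⟩ := exists_Ioc_subset_of_mem_nhds (hso.mem_nhds h) ⟨A - 1, by
        have := (hOs (hsO h)).1; linarith⟩
      have := csInf_le hbb (hus (⟨by linarith, by linarith⟩ : (u + sInf s) / 2 ∈ Ioc u (sInf s)))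
      linarith
    have hsup : sSup s ∉ s := by
      intro h
      obtain ⟨u, hu, hus⟩ := exists_Ico_subset_of_mem_nhds (hso.mem_nhds h) ⟨B + 1, by
        have := (hOs (hsO h)).2; linarith⟩
      have := le_csSup hba (hus (⟨by linarith, by linarith⟩ : (u + sSup s) / 2 ∈ Ico (sSup s) u))
      linarith
    have hIoo : s = Ioo (sInf s) (sSup s) := by
      apply subset_antisymm
      · intro z hz
        exact ⟨lt_of_le_of_ne (csInf_le hbb hz) fun h => hinf (h ▸ hz),
          lt_of_le_of_ne (le_csSup hba hz) fun h => hsup (h ▸ hz)⟩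
      · exact IsConnected.Ioo_csInf_csSup_subset ⟨⟨x, hxs⟩, hsc⟩ hbb hba
    refine ⟨sInf s, sSup s, le_csInf ⟨x, hxs⟩ fun z hz => (hOs (hsO hz)).1.le, ?_,
      csSup_le ⟨x, hxs⟩ fun z hz => (hOs (hsO hz)).2.le, hIoo,
      fun h => hinf (hclosed _ (csInf_mem_closure ⟨x, hxs⟩ hbb) h),
      fun h => hsup (hclosed _ (csSup_mem_closure ⟨x, hxs⟩ hba) h)⟩
    have := hIoo ▸ hxs
    exact this.1.trans this.2

/-- The rising sun lemma: an inequality between two measures on all intervals in which the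
averages of `m` up to the right end point are at least `l` passes to the whole set where the right
maximal function of `m` exceeds `l`. -/
theorem measure_riseSet_le (m : Measure ℝ) [IsFiniteMeasure m] [NullSingletonClass m] {l A B : ℝ}
    (hl : 0 ≤ l) (μ ν : Measure ℝ)
    (h : ∀ a b, A ≤ a → a < b → b ≤ B →
      (∀ x ∈ Ioo a b, ENNReal.ofReal (l * (b - x)) ≤ m (Ioo x b)) →
      (A < a → m (Ioo a b) ≤ ENNReal.ofReal (l * (b - a))) → μ (Ioo a b) ≤ ν (Ioo a b)) :
    IsOpen (riseSet m l A B) ∧ μ (riseSet m l A B) ≤ ν (Ioo A B) := by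
  obtain ⟨F, hF, hFm⟩ := exists_continuous_measure_Ioo m
  -- With the profile `F x - l * x`, the rise set consists of the points having a strictly higher
  -- point to their right.
  have hiff : ∀ x y, x ≤ y →
      (ENNReal.ofReal (l * (y - x)) < m (Ioo x y) ↔ F x - l * x < F y - l * y) := by
    intro x y hxy
    rw [(hFm x y hxy).2, ENNReal.ofReal_lt_ofReal_iff_of_nonneg
      (mul_nonneg hl (sub_nonneg.2 hxy))]
    constructor <;> intro h <;> linarith
  have hset : riseSet m l A B =
      Ioo A B ∩ ⋃ y ∈ Iic B, {x | x < y} ∩ {x | F x - l * x < F y - l * y} := by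
    ext x
    simp only [riseSet, mem_ofPred_eq, mem_inter_iff, mem_iUnion, mem_Iic, exists_prop,
      and_congr_right_iff]
    intro _
    refine exists_congr fun y => ?_
    constructor
    · rintro ⟨h1, h2, h3⟩
      exact ⟨h2, h1, (hiff x y h1.le).1 h3⟩
    · rintro ⟨h2, h1, h3⟩
      exact ⟨h1, h2, (hiff x y h1.le).2 h3⟩
  have hopen : IsOpen (riseSet m l A B) := by
    rw [hset]
    refine isOpen_Ioo.inter (isOpen_biUnion fun y _ => ?_)
    exact (isOpen_lt continuous_id continuous_const).inter
      (isOpen_lt (by fun_prop) continuous_const)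
  refine ⟨hopen, ?_⟩
  obtain ⟨I, hIc, hId, hIU, hI⟩ := exists_components hopen (riseSet_subset m l A B)
  have hcomp : ∀ s ∈ I, μ s ≤ ν s := by
    intro s hs
    obtain ⟨a, b, hAa, hab, hbB, rfl, ha, hb⟩ := hI s hs
    have hsub : Ioo a b ⊆ riseSet m l A B := hIU ▸ subset_sUnion_of_mem hs
    have hmono : ∀ x ∈ Ioo a b, F x - l * x ≤ F b - l * b := by
      intro x hx
      -- If the profile on `[x, b]` peaks at some `y < b`, then `y` is in the rise set and sees a
      -- higher `z`. If `z ≤ b` this contradicts the maximum; if `z > b` then `b` sees `z` too and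
      -- would belong to the rise set.
      obtain ⟨y, hy, hmax⟩ := isCompact_Icc.exists_isMaxOn (nonempty_Icc.2 hx.2.le)
        (f := fun z => F z - l * z) (by fun_prop)
      rcases eq_or_lt_of_le hy.2 with rfl | hyb
      · exact hmax (left_mem_Icc.2 hx.2.le)
      · exfalso
        obtain ⟨_, z, hyz, hzB, hz⟩ := hsub ⟨hx.1.trans_le hy.1, hyb⟩
        rw [hiff _ _ hyz.le] at hz
        rcases le_or_gt z b with hzb | hzb
        · exact absurd (hmax (⟨hy.1.trans hyz.le, hzb⟩ : z ∈ Icc x b)) (not_le.2 hz)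
        · refine hb ⟨⟨hAa.trans_lt hab, hzb.trans_le hzB⟩, z, hzb, hzB, ?_⟩
          rw [hiff _ _ hzb.le]
          exact lt_of_le_of_lt (hmax (right_mem_Icc.2 hx.2.le)) hz
    refine h a b hAa hab hbB ?_ ?_
    · intro x hx
      rw [(hFm x b hx.2.le).2]
      have := hmono x hx
      exact ENNReal.ofReal_le_ofReal (by linarith)
    -- When `A < a`, the only way for `a` to miss the rise set is that no mean starting at `a`
    -- exceeds `l`. When `a = A` it is missed by definition, and nothing follows.
    · intro hA
      by_contra! hlt
      exact ha ⟨⟨hA, hab.trans_le hbB⟩, b, hab, hbB, hlt⟩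
  have hIm : ∀ s ∈ I, MeasurableSet s := by
    intro s hs
    obtain ⟨a, b, -, -, -, rfl, -⟩ := hI s hs
    exact measurableSet_Ioo
  calc μ (riseSet m l A B) = ∑' s : I, μ s := by
        rw [← hIU, measure_sUnion hIc hId hIm]
    _ ≤ ∑' s : I, ν s := ENNReal.tsum_le_tsum fun s => hcomp s s.2
    _ = ν (riseSet m l A B) := by rw [← hIU, measure_sUnion hIc hId hIm]
    _ ≤ ν (Ioo A B) := measure_mono (riseSet_subset m l A B)

/-! ### The weak type inequality -/

/-- The one-sided Muckenhoupt condition on `[A, B]` for a pair of measures. -/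
def OneSidedAp (p : ℝ) (K : ℝ≥0) (A B : ℝ) (W S : Measure ℝ) : Prop :=
  ∀ a b c, A ≤ a → a < b → b < c → c ≤ B →
    W (Ioo a b) * S (Ioo b c) ^ (p - 1) ≤ K * ENNReal.ofReal (c - a) ^ p

theorem OneSidedAp.mono {p : ℝ} {K : ℝ≥0} {A B A' B' : ℝ} {W S : Measure ℝ}
    (h : OneSidedAp p K A B W S) (hA : A ≤ A') (hB : B' ≤ B) : OneSidedAp p K A' B' W S :=
  fun a b c h1 h2 h3 h4 => h a b c (hA.trans h1) h2 h3 (h4.trans hB)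

/-- The estimate for one piece: `W` lives on `(x, y)` while `m`, `V` and `S` live on the next piece
`(y, z)`, as the one-sided condition requires. After multiplication by `(b - x) ^ p`, the mass bound
`hm`, the Hölder bound `hH` and the condition apply in turn, and `z - x ≤ b - x` allows
cancellation. -/
theorem weakType_step {p : ℝ} (hp : 1 < p) {K : ℝ≥0} {A B : ℝ} {W S V m : Measure ℝ}
    (hA : OneSidedAp p K A B W S) {l x y z b : ℝ} (hl : 0 ≤ l) (hx : A ≤ x) (hxy : x < y)
    (hyz : y < z) (hzb : z ≤ b) (hzB : z ≤ B)
    (hH : m (Ioo y z) ^ p ≤ V (Ioo y z) * S (Ioo y z) ^ (p - 1))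
    (hm : ENNReal.ofReal (l * (b - x)) ≤ 4 * m (Ioo y z)) :
    ENNReal.ofReal l ^ p * W (Ioo x y) ≤ 4 ^ p * K * V (Ioo y z) := by
  have hp0 : 0 ≤ p := by linarith
  have hbx : 0 < b - x := by linarith
  have h0 : ENNReal.ofReal (b - x) ^ p ≠ 0 := by
    rw [Ne, ENNReal.rpow_eq_zero_iff_of_pos (by linarith)]
    simpa using hbx
  have ht : ENNReal.ofReal (b - x) ^ p ≠ ∞ := by simp [hp0]
  refine (ENNReal.mul_le_mul_iff_left h0 ht).1 ?_
  calc ENNReal.ofReal l ^ p * W (Ioo x y) * ENNReal.ofReal (b - x) ^ p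
      = W (Ioo x y) * ENNReal.ofReal (l * (b - x)) ^ p := by
        rw [ENNReal.ofReal_mul hl, ENNReal.mul_rpow_of_nonneg _ _ hp0]; ring
    _ ≤ W (Ioo x y) * (4 * m (Ioo y z)) ^ p := by gcongr
    _ = 4 ^ p * (W (Ioo x y) * m (Ioo y z) ^ p) := by
        rw [ENNReal.mul_rpow_of_nonneg _ _ hp0]; ring
    _ ≤ 4 ^ p * (W (Ioo x y) * (V (Ioo y z) * S (Ioo y z) ^ (p - 1))) := by gcongr
    _ = 4 ^ p * V (Ioo y z) * (W (Ioo x y) * S (Ioo y z) ^ (p - 1)) := by ring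
    _ ≤ 4 ^ p * V (Ioo y z) * (K * ENNReal.ofReal (z - x) ^ p) := by
        exact mul_le_mul_right (hA x y z hx hxy hyz hzB) _
    _ ≤ 4 ^ p * V (Ioo y z) * (K * ENNReal.ofReal (b - x) ^ p) := by gcongr
    _ = 4 ^ p * K * V (Ioo y z) * ENNReal.ofReal (b - x) ^ p := by ring

/-- Choose `x k` with `m (x k, b) = G / 2 ^ k`. The piece after next to `x k`, namely `(x (k + 1), x
(k + 2))`, carries exactly a quarter of `m (x k, b)`, which is the source of the factor `4`. The
pieces are disjoint, so the estimates of `weakType_step` add up. They exhaust `(a, b)` because `l *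
(b - x k) ≤ G / 2 ^ k`. -/
theorem weakType_component {p : ℝ} (hp : 1 < p) {K : ℝ≥0} {A B : ℝ} {W S V m : Measure ℝ}
    [IsFiniteMeasure m] [NullSingletonClass m] [NullSingletonClass W] (hA : OneSidedAp p K A B W S)
    (hH : ∀ y z, A ≤ y → y < z → z ≤ B →
      m (Ioo y z) ^ p ≤ V (Ioo y z) * S (Ioo y z) ^ (p - 1))
    {l a b : ℝ} (hl : 0 < l) (haA : A ≤ a) (hab : a < b) (hbB : b ≤ B)
    (hm : ∀ x ∈ Ioo a b, ENNReal.ofReal (l * (b - x)) ≤ m (Ioo x b)) :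
    ENNReal.ofReal l ^ p * W (Ioo a b) ≤ 4 ^ p * K * V (Ioo a b) := by
  obtain ⟨F, hF, hFm⟩ := exists_continuous_measure_Ioo m
  have hmF : ∀ x ∈ Ioo a b, l * (b - x) ≤ F b - F x := by
    intro x hx
    have := hm x hx
    rw [(hFm x b hx.2.le).2] at this
    exact (ENNReal.ofReal_le_ofReal_iff (by linarith [(hFm x b hx.2.le).1])).1 this
  have hmF' : ∀ x ∈ Icc a b, l * (b - x) ≤ F b - F x := by
    intro x hx
    have hcl : closure (Ioo a b) ⊆ {x | l * (b - x) ≤ F b - F x} :=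
      closure_minimal hmF (isClosed_le (by fun_prop) (by fun_prop))
    rw [closure_Ioo hab.ne] at hcl
    exact hcl hx
  set G := F b - F a with hG
  have hGpos : 0 < G := lt_of_lt_of_le (mul_pos hl (sub_pos.2 hab)) (hmF' a ⟨le_rfl, hab.le⟩)
  have hex : ∀ k : ℕ, ∃ x ∈ Icc a b, F b - F x = G / 2 ^ k := by
    intro k
    have := intermediate_value_Icc' hab.le (f := fun x => F b - F x) (by fun_prop)
    have hk : G / 2 ^ k ∈ Icc (F b - F b) (F b - F a) :=
      ⟨by rw [sub_self]; positivity, div_le_self hGpos.le (one_le_pow₀ one_le_two)⟩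
    obtain ⟨x, hx, hx'⟩ := this hk
    exact ⟨x, hx, hx'⟩
  choose x0 hx0 hFx0 using hex
  -- The value at `0` is forced to be `a`: if `F` is flat near `a`, the intermediate value theorem
  -- could return a later point and leave an initial segment uncovered.
  let x : ℕ → ℝ := fun k => if k = 0 then a else x0 k
  have hx : ∀ k, x k ∈ Icc a b := by
    intro k; by_cases hk : k = 0 <;> simp [x, hk, hab.le]
    exact hx0 k
  have hFx : ∀ k, F b - F (x k) = G / 2 ^ k := by
    intro k; by_cases hk : k = 0 <;> simp [x, hk, hFx0, hG]
  have hlt : ∀ k, x k < x (k + 1) := by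
    intro k
    by_contra! hle
    have h1 := (hFm _ _ hle).1
    have h2 : G / 2 ^ (k + 1) < G / 2 ^ k :=
      div_lt_div_of_pos_left hGpos (by positivity) (pow_lt_pow_right₀ one_lt_two (by simp))
    linarith [hFx k, hFx (k + 1)]
  have hmono : StrictMono x := strictMono_nat_of_lt_succ hlt
  have hcover : Ioo a b ⊆ ⋃ k, Ico (x k) (x (k + 1)) := by
    intro z hz
    have hne : ∃ k, z < x k := by
      by_contra! hcon
      have h1 : ∀ k : ℕ, l * (b - z) ≤ G * (1 / 2) ^ k := by
        intro k
        have h3 := hFx k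
        have h4 : G / 2 ^ k = G * (1 / 2) ^ k := by rw [one_div, inv_pow]; rfl
        have h5 := hmF' (x k) (hx k)
        have h6 : l * (b - z) ≤ l * (b - x k) :=
          mul_le_mul_of_nonneg_left (by linarith [hcon k]) hl.le
        linarith [hcon k]
      have h2 : Filter.Tendsto (fun k : ℕ => G * (1 / 2 : ℝ) ^ k) Filter.atTop (nhds (G * 0)) :=
        (tendsto_pow_atTop_nhds_zero_of_lt_one (by norm_num) (by norm_num)).const_mul G
      have h3 := ge_of_tendsto' h2 h1
      have h4 : 0 < l * (b - z) := mul_pos hl (sub_pos.2 hz.2)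
      linarith
    classical
    have hk := Nat.find_spec hne
    have hk0 : Nat.find hne ≠ 0 := by
      intro h0
      rw [h0] at hk
      simp only [x, if_true] at hk
      exact absurd hz.1 (not_lt.2 hk.le)
    obtain ⟨j, hj⟩ := Nat.exists_eq_succ_of_ne_zero hk0
    refine mem_iUnion.2 ⟨j, ?_, ?_⟩
    · exact not_lt.1 (Nat.find_min hne (by omega))
    · rw [hj] at hk; exact hk
  have hstep : ∀ k, ENNReal.ofReal l ^ p * W (Ico (x k) (x (k + 1))) ≤
      4 ^ p * K * V (Ioo (x (k + 1)) (x (k + 1 + 1))) := by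
    intro k
    rw [← Ioo_ae_eq_Ico.measure_eq]
    refine weakType_step hp hA hl.le (haA.trans (hx k).1) (hlt k) (hlt (k + 1))
      (hx _).2 ((hx _).2.trans hbB)
      (hH _ _ (haA.trans (hx _).1) (hlt _) ((hx _).2.trans hbB)) ?_
    rw [(hFm _ _ (hlt (k + 1)).le).2, show (4 : ℝ≥0∞) = ENNReal.ofReal 4 by norm_num,
      ← ENNReal.ofReal_mul (by norm_num)]
    apply ENNReal.ofReal_le_ofReal
    have h1 := hmF' (x k) (hx k)
    have e0 := hFx k
    have e1 := hFx (k + 1)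
    have e2 := hFx (k + 1 + 1)
    rw [pow_succ, ← div_div] at e1
    rw [pow_succ, pow_succ, ← div_div, ← div_div] at e2
    linarith
  calc ENNReal.ofReal l ^ p * W (Ioo a b)
      ≤ ENNReal.ofReal l ^ p * ∑' k, W (Ico (x k) (x (k + 1))) := by
        gcongr; exact (measure_mono hcover).trans (measure_iUnion_le _)
    _ = ∑' k, ENNReal.ofReal l ^ p * W (Ico (x k) (x (k + 1))) := ENNReal.tsum_mul_left.symm
    _ ≤ ∑' k, 4 ^ p * K * V (Ioo (x (k + 1)) (x (k + 1 + 1))) := ENNReal.tsum_le_tsum hstep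
    _ = 4 ^ p * K * ∑' k, V (Ioo (x (k + 1)) (x (k + 1 + 1))) := ENNReal.tsum_mul_left
    _ = 4 ^ p * K * V (⋃ k, Ioo (x (k + 1)) (x (k + 1 + 1))) := by
        rw [measure_iUnion _ fun _ => measurableSet_Ioo]
        have h1 : Monotone fun k => x (k + 1) := fun i j hij => hmono.monotone (by omega)
        exact h1.pairwise_disjoint_on_Ioo_succ
    _ ≤ 4 ^ p * K * V (Ioo a b) := by
        gcongr
        exact iUnion_subset fun k => Ioo_subset_Ioo (hx _).1 (hx _).2

/-- The weak type inequality for the right maximal function under the one-sided Muckenhoupt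
condition. -/
theorem weakType {p : ℝ} (hp : 1 < p) {K : ℝ≥0} {A B : ℝ} {W S V m : Measure ℝ}
    [IsFiniteMeasure m] [NullSingletonClass m] [NullSingletonClass W] (hA : OneSidedAp p K A B W S)
    (hH : ∀ y z, A ≤ y → y < z → z ≤ B →
      m (Ioo y z) ^ p ≤ V (Ioo y z) * S (Ioo y z) ^ (p - 1))
    {l : ℝ} (hl : 0 < l) :
    ENNReal.ofReal l ^ p * W (riseSet m l A B) ≤ 4 ^ p * K * V (Ioo A B) := by
  have := (measure_riseSet_le m (A := A) (B := B) hl.le (ENNReal.ofReal l ^ p • W)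
    ((4 ^ p * (K : ℝ≥0∞)) • V) ?_).2
  · simpa using this
  · intro a b ha hab hb hm _
    simpa using weakType_component hp hA hH hl ha hab hb hm

/-! ### The reverse Hölder inequality -/

theorem measureReal_Ioo_eq {g : ℝ → ℝ≥0∞} (hg : Measurable g) (hgt : ∀ x, g x ≠ ∞)
    {x y : ℝ} (hxy : x ≤ y) :
    (volume.withDensity g).real (Ioo x y) = ∫ t in x..y, (g t).toReal := by
  rw [intervalIntegral.integral_of_le hxy, integral_Ioc_eq_integral_Ioo,
    integral_toReal hg.aemeasurable (Filter.Eventually.of_forall fun x => (hgt x).lt_top),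
    Measure.real, withDensity_apply _ measurableSet_Ioo]

/-- By Lebesgue's differentiation theorem, a density is almost everywhere bounded by its right
maximal function. -/
theorem ae_mem_riseSet {g : ℝ → ℝ≥0∞} (hg : Measurable g) (hgt : ∀ x, g x ≠ ∞) {A B l : ℝ}
    (hfin : (volume.withDensity g) (Ioo A B) ≠ ∞) (hl : 0 ≤ l) :
    ∀ᵐ x, x ∈ Ioo A B → ENNReal.ofReal l < g x →
      x ∈ riseSet ((volume.withDensity g).restrict (Ioo A B)) l A B := by
  rcases le_or_gt B A with hBA | hAB
  · simp [Ioo_eq_empty_of_le hBA]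
  have hint : IntegrableOn (fun t => (g t).toReal) (Ioo A B) := by
    refine integrable_toReal_of_lintegral_ne_top hg.aemeasurable ?_
    rwa [withDensity_apply _ measurableSet_Ioo] at hfin
  have hii : IntervalIntegrable (fun t => (g t).toReal) volume A B := by
    rw [intervalIntegrable_iff_integrableOn_Ioc_of_le hAB.le, integrableOn_Ioc_iff_integrableOn_Ioo]
    exact hint
  filter_upwards [hii.ae_hasDerivAt_integral] with x hx hxAB hlx
  rw [uIcc_of_le hAB.le] at hx
  have hd := hx ⟨hxAB.1.le, hxAB.2.le⟩ A ⟨le_rfl, hAB.le⟩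
  -- The derivative of the primitive at `x` is `g x > l`, so some slope to the right of `x`, that is
  -- some right mean of `g`, exceeds `l`.
  have hlt : l < (g x).toReal := (ENNReal.ofReal_lt_iff_lt_toReal hl (hgt x)).1 hlx
  have hs := (hasDerivAt_iff_tendsto_slope.1 hd).eventually_const_lt hlt
  have hs' := hs.filter_mono (nhdsWithin_mono x (fun y (hy : y ∈ Ioi x) => ne_of_gt hy))
  obtain ⟨y, hy, hxy⟩ := (hs'.and (Ioo_mem_nhdsGT hxAB.2)).exists
  refine ⟨hxAB, y, hxy.1, hxy.2.le, ?_⟩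
  rw [slope_def_field, lt_div_iff₀ (sub_pos.2 hxy.1),
    intervalIntegral.integral_interval_sub_left, ← measureReal_Ioo_eq hg hgt hxy.1.le] at hy
  · rw [Measure.restrict_apply measurableSet_Ioo,
      inter_eq_self_of_subset_left (Ioo_subset_Ioo hxAB.1.le hxy.2.le)]
    have hne : (volume.withDensity g) (Ioo x y) ≠ ∞ :=
      ne_top_of_le_ne_top hfin (measure_mono (Ioo_subset_Ioo hxAB.1.le hxy.2.le))
    exact (ENNReal.ofReal_lt_iff_lt_toReal (mul_nonneg hl (sub_pos.2 hxy.1).le) hne).2 hy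
  · exact hii.mono_set (by rw [uIcc_of_le hAB.le, uIcc_of_le (hxAB.1.trans hxy.1).le]
                           exact Icc_subset_Icc le_rfl hxy.2.le)
  · exact hii.mono_set (by rw [uIcc_of_le hAB.le, uIcc_of_le hxAB.1.le]
                           exact Icc_subset_Icc le_rfl hxAB.2.le)

/-- On an interval `(a, b)` where the mean of `s` is about `l`, the dual weight `s` is bounded
below by a multiple of `l` on a large part of the interval. -/
theorem goodLambda_component {p : ℝ} (hp : 1 < p) {K : ℝ≥0} {w s : ℝ → ℝ≥0∞} (hw : Measurable w)
    (hs : Measurable s) (hws : ∀ x, w x * s x ^ (p - 1) = 1) {β : ℝ} (hβ : 0 < β)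
    (hβK : ENNReal.ofReal (2 * β) ^ (p - 1) * K ≤ ENNReal.ofReal (1 / 4)) {l a b : ℝ} (hl : 0 < l)
    (hab : a < b)
    (hA : OneSidedAp p K a b (volume.withDensity w) (volume.withDensity s))
    (hm : ∀ x ∈ Ioo a b, ENNReal.ofReal (l * (b - x)) ≤ (volume.withDensity s) (Ioo x b)) :
    ENNReal.ofReal (b - a) ≤
      4 * volume ({x | ENNReal.ofReal (β * l) ≤ s x} ∩ Ioo a b) := by
  have hp1 : 0 < p - 1 := by linarith
  set c := (a + b) / 2 with hc
  have hac : a < c := by rw [hc]; linarith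
  have hcb : c < b := by rw [hc]; linarith
  set G : Set ℝ := {x | ENNReal.ofReal (β * l) ≤ s x} with hG
  have hGm : MeasurableSet G := measurableSet_le measurable_const hs
  -- `D` is the part of the left half where `s < β * l`. There `1 = w * s ^ (p - 1) ≤ (β * l) ^ (p -
  -- 1) * w`, so its length is controlled by the `w`-mass of the left half. The `s`-mass of the
  -- right half is at least `l * (b - a) / 2`. The one-sided condition across the midpoint and the
  -- choice of `β` then leave `D` at most a quarter of `(a, b)`.
  set D := Gᶜ ∩ Ioo a c with hD
  have hDm : MeasurableSet D := hGm.compl.inter measurableSet_Ioo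
  have hDW : volume D ≤ ENNReal.ofReal (β * l) ^ (p - 1) * (volume.withDensity w) (Ioo a c) := by
    calc volume D = ∫⁻ x in D, 1 := by simp
      _ ≤ ∫⁻ x in D, ENNReal.ofReal (β * l) ^ (p - 1) * w x := by
          refine setLIntegral_mono' hDm fun x hx => ?_
          have : s x < ENNReal.ofReal (β * l) := not_le.1 hx.1
          rw [← hws x, mul_comm]
          gcongr
      _ ≤ ∫⁻ x in Ioo a c, ENNReal.ofReal (β * l) ^ (p - 1) * w x :=
          lintegral_mono_set inter_subset_right
      _ = _ := by rw [lintegral_const_mul _ hw, withDensity_apply _ measurableSet_Ioo]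
  have hS : ENNReal.ofReal (l * (b - a) / 2) ≤ (volume.withDensity s) (Ioo c b) := by
    have := hm c ⟨hac, hcb⟩
    rwa [show l * (b - c) = l * (b - a) / 2 by rw [hc]; ring] at this
  have hq : 0 < l * (b - a) / 2 := by have := sub_pos.2 hab; positivity
  have hDle : volume D ≤ ENNReal.ofReal ((b - a) / 4) := by
    have h0 : ENNReal.ofReal (l * (b - a) / 2) ^ (p - 1) ≠ 0 := by
      rw [Ne, ENNReal.rpow_eq_zero_iff_of_pos hp1]; simpa using hq
    have ht : ENNReal.ofReal (l * (b - a) / 2) ^ (p - 1) ≠ ∞ :=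
      ENNReal.rpow_ne_top_of_nonneg hp1.le ENNReal.ofReal_ne_top
    refine (ENNReal.mul_le_mul_iff_left h0 ht).1 ?_
    calc volume D * ENNReal.ofReal (l * (b - a) / 2) ^ (p - 1)
        ≤ ENNReal.ofReal (β * l) ^ (p - 1) * (volume.withDensity w) (Ioo a c) *
            (volume.withDensity s) (Ioo c b) ^ (p - 1) := by gcongr
      _ ≤ ENNReal.ofReal (β * l) ^ (p - 1) * (K * ENNReal.ofReal (b - a) ^ p) := by
          rw [mul_assoc]; exact mul_le_mul_right (hA a c b le_rfl hac hcb le_rfl) _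
      _ = (ENNReal.ofReal (2 * β) ^ (p - 1) * K) * ENNReal.ofReal (b - a) *
            ENNReal.ofReal (l * (b - a) / 2) ^ (p - 1) := by
          have e1 : ENNReal.ofReal (b - a) ^ p =
              ENNReal.ofReal (b - a) * ENNReal.ofReal (b - a) ^ (p - 1) := by
            conv_lhs => rw [show p = 1 + (p - 1) by ring]
            rw [ENNReal.rpow_add_of_nonneg _ _ zero_le_one hp1.le, ENNReal.rpow_one]
          have e2 : ENNReal.ofReal (β * l) ^ (p - 1) * ENNReal.ofReal (b - a) ^ (p - 1) =
              ENNReal.ofReal (2 * β) ^ (p - 1) * ENNReal.ofReal (l * (b - a) / 2) ^ (p - 1) := by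
            rw [← ENNReal.mul_rpow_of_nonneg _ _ hp1.le, ← ENNReal.mul_rpow_of_nonneg _ _ hp1.le,
              ← ENNReal.ofReal_mul (by positivity), ← ENNReal.ofReal_mul (by positivity)]
            congr 2; ring
          rw [e1]
          calc _ = (ENNReal.ofReal (β * l) ^ (p - 1) * ENNReal.ofReal (b - a) ^ (p - 1)) * K *
                ENNReal.ofReal (b - a) := by ring
            _ = _ := by rw [e2]; ring
      _ ≤ ENNReal.ofReal (1 / 4) * ENNReal.ofReal (b - a) *
            ENNReal.ofReal (l * (b - a) / 2) ^ (p - 1) := by gcongr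
      _ = _ := by
          rw [← ENNReal.ofReal_mul (by norm_num)]; congr 2; ring
  have hsum : ENNReal.ofReal ((b - a) / 2) ≤
      volume (G ∩ Ioo a b) + ENNReal.ofReal ((b - a) / 4) := by
    calc ENNReal.ofReal ((b - a) / 2) = volume (Ioo a c) := by
          rw [Real.volume_Ioo]; congr 1; rw [hc]; ring
      _ ≤ volume ((G ∩ Ioo a b) ∪ D) := by
          refine measure_mono fun x hx => ?_
          by_cases hxG : x ∈ G
          · exact Or.inl ⟨hxG, hx.1, hx.2.trans hcb⟩
          · exact Or.inr ⟨hxG, hx⟩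
      _ ≤ volume (G ∩ Ioo a b) + volume D := measure_union_le _ _
      _ ≤ _ := by gcongr
  have hfin : volume (G ∩ Ioo a b) ≠ ∞ :=
    ne_top_of_le_ne_top (by simp) (measure_mono inter_subset_right : _ ≤ volume (Ioo a b))
  rw [← ENNReal.ofReal_toReal hfin] at hsum ⊢
  rw [← ENNReal.ofReal_add ENNReal.toReal_nonneg (by linarith),
    ENNReal.ofReal_le_ofReal_iff (by
      have := ENNReal.toReal_nonneg (a := volume (G ∩ Ioo a b)); linarith)] at hsum
  rw [show (4 : ℝ≥0∞) = ENNReal.ofReal 4 by norm_num, ← ENNReal.ofReal_mul (by norm_num)]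
  exact ENNReal.ofReal_le_ofReal (by linarith)

/-- Almost every point with `s > l` lies in the rise set. On each of its components the mean of `s`
is at most `l`, while `s ≥ β * l` on at least a quarter of the length, by `goodLambda_component`.
The rising sun lemma sums the components. -/
theorem goodLambda {p : ℝ} (hp : 1 < p) {K : ℝ≥0} {w s : ℝ → ℝ≥0∞} (hw : Measurable w)
    (hs : Measurable s) (hws : ∀ x, w x * s x ^ (p - 1) = 1) {β : ℝ} (hβ : 0 < β)
    (hβK : ENNReal.ofReal (2 * β) ^ (p - 1) * K ≤ ENNReal.ofReal (1 / 4)) {l A B : ℝ} (hl : 0 < l)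
    (hA : OneSidedAp p K A B (volume.withDensity w) (volume.withDensity s))
    (hfin : (volume.withDensity s) (Ioo A B) ≠ ∞)
    (hle : ∀ y, A < y → y ≤ B → (volume.withDensity s) (Ioo A y) ≤ ENNReal.ofReal (l * (y - A))) :
    (volume.withDensity s) ({x | ENNReal.ofReal l < s x} ∩ Ioo A B) ≤
      ENNReal.ofReal (4 * l) * volume ({x | ENNReal.ofReal (β * l) ≤ s x} ∩ Ioo A B) := by
  have hp1 : 0 < p - 1 := by linarith
  set S := volume.withDensity s with hS
  have hst : ∀ x, s x ≠ ∞ := by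
    intro x hx
    have := hws x
    rw [hx, ENNReal.top_rpow_of_pos hp1] at this
    rcases eq_or_ne (w x) 0 with h | h
    · simp [h] at this
    · simp [ENNReal.mul_top h] at this
  have : Fact (S (Ioo A B) < ∞) := ⟨hfin.lt_top⟩
  set ν : Measure ℝ := ENNReal.ofReal (4 * l) • volume.restrict {x | ENNReal.ofReal (β * l) ≤ s x}
    with hν
  have hGm : MeasurableSet {x | ENNReal.ofReal (β * l) ≤ s x} :=
    measurableSet_le measurable_const hs
  have hνI : ∀ a b, ν (Ioo a b) = ENNReal.ofReal (4 * l) *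
      volume ({x | ENNReal.ofReal (β * l) ≤ s x} ∩ Ioo a b) := by
    intro a b
    rw [hν, Measure.smul_apply, Measure.restrict_apply measurableSet_Ioo, smul_eq_mul, inter_comm]
  have hrestr : ∀ a b, A ≤ a → b ≤ B → S.restrict (Ioo A B) (Ioo a b) = S (Ioo a b) := by
    intro a b ha hb
    rw [Measure.restrict_apply measurableSet_Ioo,
      inter_eq_self_of_subset_left (Ioo_subset_Ioo ha hb)]
  have hrise := (measure_riseSet_le (S.restrict (Ioo A B)) (A := A) (B := B) hl.le S ν ?_).2
  · rw [hνI] at hrise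
    refine le_trans (measure_mono_ae ?_) hrise
    have hac : S ≪ volume := withDensity_absolutelyContinuous _ _
    filter_upwards [hac.ae_le (ae_mem_riseSet hs hst hfin hl.le)] with x hx hxm
    exact hx hxm.2 hxm.1
  · intro a b ha hab hb hm hmA
    -- A component starting at `A` gets no upper bound from the rising sun lemma; `hle` supplies it.
    have hmean : S (Ioo a b) ≤ ENNReal.ofReal (l * (b - a)) := by
      rcases eq_or_lt_of_le ha with rfl | ha'
      · exact hle b hab hb
      · rw [← hrestr a b ha hb]; exact hmA ha'
    rw [hνI]
    calc S (Ioo a b) ≤ ENNReal.ofReal l * ENNReal.ofReal (b - a) := by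
          rwa [← ENNReal.ofReal_mul hl.le]
      _ ≤ ENNReal.ofReal l * (4 * volume ({x | ENNReal.ofReal (β * l) ≤ s x} ∩ Ioo a b)) := by
          gcongr
          refine goodLambda_component hp hw hs hws hβ hβK hl hab (hA.mono ha hb) fun x hx => ?_
          rw [← hS, ← hrestr x b (ha.trans hx.1.le) hb]
          exact hm x hx
      _ = _ := by
          rw [ENNReal.ofReal_mul (p := 4) (by norm_num), ENNReal.ofReal_ofNat]
          ring

theorem ne_zero_and_ne_top_of_mul_rpow {q : ℝ} (hq : 0 < q) {x y : ℝ≥0∞} (h : x * y ^ q = 1) :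
    x ≠ 0 ∧ x ≠ ∞ ∧ y ≠ 0 ∧ y ≠ ∞ := by
  have hx0 : x ≠ 0 := by rintro rfl; simp at h
  have hy0 : y ≠ 0 := by rintro rfl; simp [hq] at h
  refine ⟨hx0, ?_, hy0, ?_⟩
  · rintro rfl
    rw [ENNReal.top_mul (by simp [ENNReal.rpow_eq_zero_iff, hy0, hq.le])] at h
    simp at h
  · rintro rfl
    rw [ENNReal.top_rpow_of_pos hq, ENNReal.mul_top hx0] at h
    simp at h

/-- The reverse Hölder inequality for a truncated density. -/
theorem reverseHolder_truncated {p : ℝ} (hp : 1 < p) {K : ℝ≥0} {w s : ℝ → ℝ≥0∞}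
    (hw : Measurable w) (hs : Measurable s) (hws : ∀ x, w x * s x ^ (p - 1) = 1) {β : ℝ}
    (hβ : 0 < β) (hβ1 : β ≤ 1)
    (hβK : ENNReal.ofReal (2 * β) ^ (p - 1) * K ≤ ENNReal.ofReal (1 / 4)) {δ : ℝ} (hδ : 0 < δ)
    (hδ1 : δ ≤ 1) (hδβ : 8 * δ ≤ β ^ 2) {l A B : ℝ} (hl : 0 < l)
    (hA : OneSidedAp p K A B (volume.withDensity w) (volume.withDensity s))
    (hfin : (volume.withDensity s) (Ioo A B) ≠ ∞)
    (hle : ∀ y, A < y → y ≤ B → (volume.withDensity s) (Ioo A y) ≤ ENNReal.ofReal (l * (y - A)))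
    (N : ℕ) :
    ∫⁻ x in Ioo A B, ENNReal.ofReal (min (s x).toReal N ^ δ) ∂(volume.withDensity s) ≤
      2 * (ENNReal.ofReal (l ^ δ) * (volume.withDensity s) (Ioo A B)) := by
  have hst : ∀ x, s x ≠ ∞ := fun x =>
    (ne_zero_and_ne_top_of_mul_rpow (by linarith) (hws x)).2.2.2
  set S := volume.withDensity s with hS
  set μ := S.restrict (Ioo A B) with hμ
  -- Truncation makes the integral finite, so that half of it can be subtracted at the end.
  set X : ℝ → ℝ := fun x => min (s x).toReal N with hX
  have hX0 : ∀ x, 0 ≤ X x := fun x => le_min ENNReal.toReal_nonneg (Nat.cast_nonneg N)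
  have hXm : Measurable X := hs.ennreal_toReal.min measurable_const
  have hμA : μ univ = S (Ioo A B) := by simp [hμ]
  -- The set `{_x | t < l}` is everything for `t < l` and empty otherwise, so its term integrates to
  -- the layer cake formula for the constant `l`. It covers the low levels trivially; for `l ≤ t <
  -- N` the bound is `goodLambda`, and for `t ≥ N` the left side vanishes.
  have hset : ∀ t ∈ Ioi (0 : ℝ), μ {x | t < X x} * ENNReal.ofReal (t ^ (δ - 1)) ≤
      μ {_x | t < l} * ENNReal.ofReal (t ^ (δ - 1)) +
        4 * ((volume.restrict (Ioo A B)) {x | t ≤ X x / β} *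
          ENNReal.ofReal (t ^ (1 + δ - 1))) := by
    intro t ht
    have ht0 : 0 < t := ht
    have hmain : μ {x | t < X x} ≤ μ {_x | t < l} +
        ENNReal.ofReal (4 * t) * (volume.restrict (Ioo A B)) {x | t ≤ X x / β} := by
      rcases lt_or_ge t l with htl | htl
      · refine le_add_right (measure_mono fun x _ => htl)
      rcases le_or_gt (N : ℝ) t with hNt | hNt
      · have : {x | t < X x} = ∅ := by
          ext x
          exact iff_of_false (not_lt.2 ((min_le_right _ _ : X x ≤ N).trans hNt)) (notMem_empty x)
        simp [this]
      refine le_add_left ?_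
      have h1 := goodLambda hp hw hs hws hβ hβK ht0 hA hfin fun y h1 h2 =>
        (hle y h1 h2).trans (ENNReal.ofReal_le_ofReal
          (mul_le_mul_of_nonneg_right htl (sub_pos.2 h1).le))
      rw [hμ, Measure.restrict_apply (measurableSet_lt measurable_const hXm),
        Measure.restrict_apply (measurableSet_le measurable_const (hXm.div_const β))]
      refine le_trans (measure_mono ?_) (h1.trans (mul_le_mul_right (measure_mono ?_) _))
      · rintro x ⟨hx, hx'⟩
        refine ⟨?_, hx'⟩
        exact (ENNReal.ofReal_lt_iff_lt_toReal ht0.le (hst x)).2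
          (lt_of_lt_of_le hx (min_le_left _ _))
      · rintro x ⟨hx, hx'⟩
        refine ⟨?_, hx'⟩
        change t ≤ X x / β
        rw [le_div_iff₀ hβ]
        refine le_min ?_ ?_
        · rw [mul_comm]
          exact (ENNReal.ofReal_le_iff_le_toReal (hst x)).1 hx
        · nlinarith
    have hpow : ENNReal.ofReal (4 * t) * ENNReal.ofReal (t ^ (δ - 1)) =
        4 * ENNReal.ofReal (t ^ (1 + δ - 1)) := by
      rw [ENNReal.ofReal_mul (p := 4) (by norm_num), ENNReal.ofReal_ofNat, mul_assoc,
        ← ENNReal.ofReal_mul ht0.le]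
      congr 2
      rw [show 1 + δ - 1 = 1 + (δ - 1) by ring, Real.rpow_add ht0, Real.rpow_one]
    calc μ {x | t < X x} * ENNReal.ofReal (t ^ (δ - 1))
        ≤ (μ {_x | t < l} + ENNReal.ofReal (4 * t) *
            (volume.restrict (Ioo A B)) {x | t ≤ X x / β}) * ENNReal.ofReal (t ^ (δ - 1)) := by
          gcongr
      _ = μ {_x | t < l} * ENNReal.ofReal (t ^ (δ - 1)) +
          (ENNReal.ofReal (4 * t) * ENNReal.ofReal (t ^ (δ - 1))) *
            (volume.restrict (Ioo A B)) {x | t ≤ X x / β} := by ring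
      _ = _ := by rw [hpow]; ring
  have hlc1 := lintegral_rpow_eq_lintegral_meas_lt_mul μ (Filter.Eventually.of_forall hX0)
    hXm.aemeasurable hδ
  have hlc2 := lintegral_rpow_eq_lintegral_meas_lt_mul μ (f := fun _ => l)
    (Filter.Eventually.of_forall fun _ => hl.le) aemeasurable_const hδ
  have hlc3 := lintegral_rpow_eq_lintegral_meas_le_mul (volume.restrict (Ioo A B))
    (f := fun x => X x / β) (Filter.Eventually.of_forall fun x => div_nonneg (hX0 x) hβ.le)
    (hXm.div_const β).aemeasurable (p := 1 + δ) (by linarith)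
  have hmeas : Measurable fun t : ℝ => μ {_x : ℝ | t < l} * ENNReal.ofReal (t ^ (δ - 1)) := by
    refine Measurable.mul ?_ (by fun_prop)
    have : Antitone fun t : ℝ => μ {_x : ℝ | t < l} := fun a b hab =>
      measure_mono fun x (hx : b < l) => lt_of_le_of_lt hab hx
    exact this.measurable
  have hstep : ∫⁻ x, ENNReal.ofReal (X x ^ δ) ∂μ ≤ ENNReal.ofReal (l ^ δ) * μ univ +
      ENNReal.ofReal (4 * δ) *
        ∫⁻ x in Ioo A B, ENNReal.ofReal ((X x / β) ^ (1 + δ)) := by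
    calc ∫⁻ x, ENNReal.ofReal (X x ^ δ) ∂μ
        ≤ ENNReal.ofReal δ * ∫⁻ t in Ioi (0 : ℝ),
          (μ {_x | t < l} * ENNReal.ofReal (t ^ (δ - 1)) +
            4 * ((volume.restrict (Ioo A B)) {x | t ≤ X x / β} *
              ENNReal.ofReal (t ^ (1 + δ - 1)))) := by
          rw [hlc1]
          exact mul_le_mul_right (setLIntegral_mono' measurableSet_Ioi hset) _
      _ = ENNReal.ofReal (l ^ δ) * μ univ + ENNReal.ofReal δ * (4 * ∫⁻ t in Ioi (0 : ℝ),
            (volume.restrict (Ioo A B)) {x | t ≤ X x / β} *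
              ENNReal.ofReal (t ^ (1 + δ - 1))) := by
          rw [lintegral_add_left hmeas, mul_add, ← hlc2, lintegral_const,
            lintegral_const_mul' _ _ (by norm_num)]
      _ ≤ ENNReal.ofReal (l ^ δ) * μ univ + ENNReal.ofReal (4 * δ) *
            ∫⁻ x in Ioo A B, ENNReal.ofReal ((X x / β) ^ (1 + δ)) := by
          refine add_le_add le_rfl ?_
          rw [hlc3, ENNReal.ofReal_mul (p := 4) (by norm_num), ENNReal.ofReal_ofNat,
            ← mul_assoc, mul_comm (ENNReal.ofReal δ) 4]
          gcongr
          refine le_mul_of_one_le_left zero_le ?_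
          rw [ENNReal.one_le_ofReal]; linarith
  -- Pointwise `X ^ (1 + δ) ≤ s * X ^ δ`, and `4 * δ ≤ β ^ 2 / 2 ≤ β ^ (1 + δ) / 2` because `β ≤ 1`
  -- and `δ ≤ 1`. Thus the error term is at most half of the quantity being estimated.
  have habs : ENNReal.ofReal (4 * δ) *
        ∫⁻ x in Ioo A B, ENNReal.ofReal ((X x / β) ^ (1 + δ)) ≤
      2⁻¹ * ∫⁻ x, ENNReal.ofReal (X x ^ δ) ∂μ := by
    have hμ' : ∫⁻ x, ENNReal.ofReal (X x ^ δ) ∂μ =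
        ∫⁻ x in Ioo A B, s x * ENNReal.ofReal (X x ^ δ) := by
      rw [hμ, hS, restrict_withDensity measurableSet_Ioo,
        lintegral_withDensity_eq_lintegral_mul _ hs (by fun_prop)]
      rfl
    rw [hμ', ← lintegral_const_mul' _ _ ENNReal.ofReal_ne_top,
      ← lintegral_const_mul' _ _ (by simp)]
    refine lintegral_mono fun x => ?_
    have hsx : ENNReal.ofReal (X x) ≤ s x :=
      ENNReal.ofReal_le_of_le_toReal (min_le_left _ _)
    calc ENNReal.ofReal (4 * δ) * ENNReal.ofReal ((X x / β) ^ (1 + δ))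
        ≤ ENNReal.ofReal (2⁻¹ * (X x * X x ^ δ)) := by
          rw [← ENNReal.ofReal_mul (by positivity)]
          apply ENNReal.ofReal_le_ofReal
          have e1 : X x ^ (1 + δ) = X x * X x ^ δ := by
            rcases eq_or_lt_of_le (hX0 x) with h | h
            · rw [← h, Real.zero_rpow (by linarith), zero_mul]
            · rw [Real.rpow_add h, Real.rpow_one]
          have e2 : β ^ (2 : ℕ) ≤ β ^ (1 + δ) := by
            rw [← Real.rpow_natCast]
            exact Real.rpow_le_rpow_of_exponent_ge hβ hβ1 (by push_cast; linarith)
          rw [Real.div_rpow (hX0 x) hβ.le, e1]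
          have h3 : 0 ≤ X x * X x ^ δ := mul_nonneg (hX0 x) (Real.rpow_nonneg (hX0 x) _)
          have h4 : 0 < β ^ (1 + δ) := Real.rpow_pos_of_pos hβ _
          rw [← mul_div_assoc, div_le_iff₀ h4]
          nlinarith
      _ = 2⁻¹ * (ENNReal.ofReal (X x) * ENNReal.ofReal (X x ^ δ)) := by
          rw [ENNReal.ofReal_mul (by norm_num), ENNReal.ofReal_mul (hX0 x),
            ENNReal.ofReal_inv_of_pos (by norm_num), ENNReal.ofReal_ofNat]
      _ ≤ _ := by gcongr
  have hfinX : ∫⁻ x, ENNReal.ofReal (X x ^ δ) ∂μ ≠ ∞ := by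
    refine ne_top_of_le_ne_top (ENNReal.mul_ne_top (ENNReal.ofReal_ne_top (r := (N : ℝ) ^ δ))
      (hμA ▸ hfin)) (?_ : _ ≤ _ * μ univ)
    rw [← lintegral_const]
    exact lintegral_mono fun x => ENNReal.ofReal_le_ofReal
      (Real.rpow_le_rpow (hX0 x) (min_le_right _ _) hδ.le)
  have hfin' : 2⁻¹ * ∫⁻ x, ENNReal.ofReal (X x ^ δ) ∂μ ≠ ∞ := ENNReal.mul_ne_top (by simp) hfinX
  have hY : 2⁻¹ * (∫⁻ x, ENNReal.ofReal (X x ^ δ) ∂μ) ≤ ENNReal.ofReal (l ^ δ) * μ univ := by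
    have := hstep.trans (add_le_add_right habs _)
    refine (ENNReal.add_le_add_iff_right hfin').1 (le_trans (le_of_eq ?_) this)
    rw [← add_mul, ENNReal.inv_two_add_inv_two, one_mul]
  rw [hμA] at hY
  calc _ = 2 * (2⁻¹ * (∫⁻ x, ENNReal.ofReal (X x ^ δ) ∂μ)) := by
        rw [← mul_assoc, ENNReal.mul_inv_cancel (by simp) (by simp), one_mul]
    _ ≤ _ := by gcongr

/-- The one-sided reverse Hölder inequality. -/
theorem reverseHolder {p : ℝ} (hp : 1 < p) {K : ℝ≥0} {w s : ℝ → ℝ≥0∞}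
    (hw : Measurable w) (hs : Measurable s) (hws : ∀ x, w x * s x ^ (p - 1) = 1) {β : ℝ}
    (hβ : 0 < β) (hβ1 : β ≤ 1)
    (hβK : ENNReal.ofReal (2 * β) ^ (p - 1) * K ≤ ENNReal.ofReal (1 / 4)) {δ : ℝ} (hδ : 0 < δ)
    (hδ1 : δ ≤ 1) (hδβ : 8 * δ ≤ β ^ 2) {l A B : ℝ} (hl : 0 < l)
    (hA : OneSidedAp p K A B (volume.withDensity w) (volume.withDensity s))
    (hfin : (volume.withDensity s) (Ioo A B) ≠ ∞)
    (hle : ∀ y, A < y → y ≤ B → (volume.withDensity s) (Ioo A y) ≤ ENNReal.ofReal (l * (y - A))) :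
    (volume.withDensity fun x => s x ^ (1 + δ)) (Ioo A B) ≤
      2 * (ENNReal.ofReal (l ^ δ) * (volume.withDensity s) (Ioo A B)) := by
  have hst : ∀ x, s x ≠ ∞ := fun x =>
    (ne_zero_and_ne_top_of_mul_rpow (by linarith) (hws x)).2.2.2
  set S := volume.withDensity s with hS
  calc (volume.withDensity fun x => s x ^ (1 + δ)) (Ioo A B)
      = ∫⁻ x in Ioo A B, s x ^ (1 + δ) := withDensity_apply _ measurableSet_Ioo
    _ = ∫⁻ x in Ioo A B, s x * ENNReal.ofReal ((s x).toReal ^ δ) := by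
        congr 1; ext x
        rw [ENNReal.rpow_add_of_nonneg _ _ zero_le_one hδ.le, ENNReal.rpow_one,
          ← ENNReal.ofReal_rpow_of_nonneg ENNReal.toReal_nonneg hδ.le,
          ENNReal.ofReal_toReal (hst x)]
    _ = ∫⁻ x in Ioo A B, ENNReal.ofReal ((s x).toReal ^ δ) ∂S := by
        rw [hS, restrict_withDensity measurableSet_Ioo,
          lintegral_withDensity_eq_lintegral_mul _ hs (by fun_prop)]
        rfl
    _ ≤ ∫⁻ x in Ioo A B, ⨆ N : ℕ, ENNReal.ofReal (min (s x).toReal N ^ δ) ∂S := by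
        refine lintegral_mono fun x => ?_
        obtain ⟨N, hN⟩ := exists_nat_ge (s x).toReal
        refine le_iSup_of_le N ?_
        rw [min_eq_left hN]
    _ = ⨆ N : ℕ, ∫⁻ x in Ioo A B, ENNReal.ofReal (min (s x).toReal N ^ δ) ∂S := by
        refine lintegral_iSup (fun N => by fun_prop) fun M N hMN x => ?_
        refine ENNReal.ofReal_le_ofReal (Real.rpow_le_rpow
          (le_min ENNReal.toReal_nonneg (Nat.cast_nonneg _)) ?_ hδ.le)
        exact min_le_min le_rfl (Nat.cast_le.2 hMN)
    _ ≤ _ := iSup_le fun N =>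
        reverseHolder_truncated hp hw hs hws hβ hβ1 hβK hδ hδ1 hδβ hl hA hfin hle N

/-! ### The one-sided Muckenhoupt condition is open in the exponent -/

/-- Up to constants the left side is `(W * s ^ (p - 1)) ^ θ` with `θ = (1 + δ / p) / (1 + δ)`, and
`p * θ = 1 + (p - 1) / (1 + δ)`. Taking logarithms makes this linear algebra. It is the bookkeeping
for `OneSidedAp.improve`. -/
theorem rpow_bound_of_mul_rpow_le {p δ W s L k c : ℝ} (hp : 1 < p) (hδ : 0 < δ) (hW : 0 < W)
    (hs : 0 < s) (hL : 0 < L) (hk : 0 < k) (hc : 0 < c) (h : W * s ^ (p - 1) ≤ k * L ^ p) :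
    W * (2 * (((c * s / W) ^ (1 / p)) ^ δ * s)) ^ ((p - 1) / (1 + δ)) ≤
      (2 ^ ((p - 1) / (1 + δ)) * c ^ (δ / p * ((p - 1) / (1 + δ))) *
        k ^ ((1 + δ / p) / (1 + δ))) * L ^ (1 + (p - 1) / (1 + δ)) := by
  have hp0 : 0 < p := by linarith
  have hδ1 : 0 < 1 + δ := by linarith
  have hlog := Real.log_le_log (by positivity) h
  rw [Real.log_mul (by positivity) (by positivity), Real.log_rpow hs,
    Real.log_mul (by positivity) (by positivity), Real.log_rpow hL] at hlog
  rw [← Real.log_le_log_iff (by positivity) (by positivity),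
    Real.log_mul (by positivity) (by positivity), Real.log_rpow (by positivity),
    Real.log_mul (by positivity) (by positivity), Real.log_mul (by positivity) (by positivity),
    Real.log_rpow (by positivity), Real.log_rpow (by positivity),
    Real.log_div (by positivity) (by positivity), Real.log_mul (by positivity) (by positivity),
    Real.log_mul (by positivity) (by positivity), Real.log_mul (by positivity) (by positivity),
    Real.log_mul (by positivity) (by positivity), Real.log_rpow (by positivity),
    Real.log_rpow (by positivity), Real.log_rpow (by positivity), Real.log_rpow (by positivity)]
  have hq : 0 ≤ (1 + δ / p) / (1 + δ) := by positivity
  have h2 := mul_le_mul_of_nonneg_left hlog hq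
  have e1 : (1 + δ / p) / (1 + δ) * (Real.log W + (p - 1) * Real.log s) =
      Real.log W + (p - 1) / (1 + δ) *
        (δ * (1 / p * (Real.log s - Real.log W)) + Real.log s) := by
    field_simp; ring
  have e2 : (1 + δ / p) / (1 + δ) * (Real.log k + p * Real.log L) =
      (1 + δ / p) / (1 + δ) * Real.log k + (1 + (p - 1) / (1 + δ)) * Real.log L := by
    field_simp; ring
  have e3 : (p - 1) / (1 + δ) * (Real.log 2 + (δ * (1 / p * (Real.log c + Real.log s - Real.log W))
        + Real.log s)) = (p - 1) / (1 + δ) *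
        (δ * (1 / p * (Real.log s - Real.log W)) + Real.log s) +
        (p - 1) / (1 + δ) * Real.log 2 + δ / p * ((p - 1) / (1 + δ)) * Real.log c := by
    field_simp; ring
  linarith

theorem exists_half (μ : Measure ℝ) [IsFiniteMeasure μ] [NullSingletonClass μ] {a b : ℝ}
    (hab : a < b) (hpos : μ (Ioo a b) ≠ 0) :
    ∃ c, a < c ∧ c < b ∧ μ (Ioo a c) = μ (Ioo a b) / 2 ∧ μ (Ioo c b) = μ (Ioo a b) / 2 := by
  obtain ⟨F, hF, hFm⟩ := exists_continuous_measure_Ioo μ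
  have h1 := (hFm a b hab.le).2
  have hlt : F a < F b := by
    by_contra! hle
    rw [h1, ENNReal.ofReal_of_nonpos (by linarith)] at hpos
    exact hpos rfl
  obtain ⟨c, hc, hFc⟩ := intermediate_value_Icc hab.le hF.continuousOn
    (⟨by linarith, by linarith⟩ : (F a + F b) / 2 ∈ Icc (F a) (F b))
  have hca : c ≠ a := by rintro rfl; linarith
  have hcb : c ≠ b := by rintro rfl; linarith
  refine ⟨c, lt_of_le_of_ne hc.1 hca.symm, lt_of_le_of_ne hc.2 hcb, ?_, ?_⟩
  · rw [h1, (hFm a c hc.1).2, hFc, ← ENNReal.ofReal_ofNat 2,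
      ← ENNReal.ofReal_div_of_pos (by norm_num)]
    congr 1; ring
  · rw [h1, (hFm c b hc.2).2, hFc, ← ENNReal.ofReal_ofNat 2,
      ← ENNReal.ofReal_div_of_pos (by norm_num)]
    congr 1; ring

theorem withDensity_Ioo_ne_zero {g : ℝ → ℝ≥0∞} (hg : Measurable g) (h0 : ∀ x, g x ≠ 0) {a b : ℝ}
    (hab : a < b) : (volume.withDensity g) (Ioo a b) ≠ 0 := by
  rw [Ne, withDensity_apply_eq_zero hg]
  have : {x | g x ≠ 0} = univ := eq_univ_of_forall h0
  rw [this, univ_inter, Real.volume_Ioo]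
  simpa using hab

/-- The self-improvement of the one-sided Muckenhoupt condition, for an explicit exponent. -/
theorem OneSidedAp.improve {p : ℝ} (hp : 1 < p) {K : ℝ≥0} (hK : 1 ≤ K) {w s : ℝ → ℝ≥0∞}
    (hw : Measurable w) (hs : Measurable s) (hws : ∀ x, w x * s x ^ (p - 1) = 1) {β : ℝ}
    (hβ : 0 < β) (hβ1 : β ≤ 1)
    (hβK : ENNReal.ofReal (2 * β) ^ (p - 1) * K ≤ ENNReal.ofReal (1 / 4)) {δ : ℝ} (hδ : 0 < δ)
    (hδ1 : δ ≤ 1) (hδβ : 8 * δ ≤ β ^ 2) {A B : ℝ}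
    (hA : OneSidedAp p K A B (volume.withDensity w) (volume.withDensity s))
    (hwfin : (volume.withDensity w) (Ioo A B) ≠ ∞)
    (hsfin : (volume.withDensity s) (Ioo A B) ≠ ∞) :
    OneSidedAp (1 + (p - 1) / (1 + δ))
      (Real.toNNReal (2 ^ ((p - 1) / (1 + δ)) * (4 * 4 ^ p * K) ^ (δ / p * ((p - 1) / (1 + δ))) *
        (2 * K) ^ ((1 + δ / p) / (1 + δ)))) A B
      (volume.withDensity w) (volume.withDensity fun x => s x ^ (1 + δ)) := by
  intro a b c haA hab hbc hcB
  have hp1 : 0 < p - 1 := by linarith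
  have hp0 : 0 < p := by linarith
  have hr0 : 0 < (p - 1) / (1 + δ) := by positivity
  have hw0 : ∀ x, w x ≠ 0 := fun x => (ne_zero_and_ne_top_of_mul_rpow hp1 (hws x)).1
  have hs0 : ∀ x, s x ≠ 0 := fun x => (ne_zero_and_ne_top_of_mul_rpow hp1 (hws x)).2.2.1
  set W := volume.withDensity w with hW
  set S := volume.withDensity s with hS
  have hWfin : ∀ x y, A ≤ x → y ≤ B → W (Ioo x y) ≠ ∞ := fun x y h1 h2 =>
    ne_top_of_le_ne_top hwfin (measure_mono (Ioo_subset_Ioo h1 h2))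
  have hSfin : ∀ x y, A ≤ x → y ≤ B → S (Ioo x y) ≠ ∞ := fun x y h1 h2 =>
    ne_top_of_le_ne_top hsfin (measure_mono (Ioo_subset_Ioo h1 h2))
  have : Fact (W (Ioo A B) < ∞) := ⟨hwfin.lt_top⟩
  have hrestr : ∀ (μ : Measure ℝ) (A B x y : ℝ), A ≤ x → y ≤ B →
      μ.restrict (Ioo A B) (Ioo x y) = μ (Ioo x y) := by
    intro μ A B x y ha hb
    rw [Measure.restrict_apply measurableSet_Ioo,
      inter_eq_self_of_subset_left (Ioo_subset_Ioo ha hb)]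
  have hbB : b ≤ B := hbc.le.trans hcB
  -- The left half `(a, d)` serves in the one-sided condition against `S (d, c)`; the right half
  -- `(d, b)` leaves room for a good starting point `y`.
  obtain ⟨d, had, hdb, hWad, hWdb⟩ := exists_half (W.restrict (Ioo A B)) hab (by
    rw [hrestr W A B a b haA hbB]; exact withDensity_Ioo_ne_zero hw hw0 hab)
  rw [hrestr W A B a d haA (hdb.le.trans hbB), hrestr W A B a b haA hbB] at hWad
  rw [hrestr W A B d b (haA.trans had.le) hbB, hrestr W A B a b haA hbB] at hWdb
  have hdA : A ≤ d := haA.trans had.le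
  have hdc : d < c := hdb.trans hbc
  have : Fact (S (Ioo d c) < ∞) := ⟨(hSfin d c hdA hcB).lt_top⟩
  set ω := (W (Ioo a b)).toReal with hω
  set σ := (S (Ioo d c)).toReal with hσ
  have hωe : W (Ioo a b) = ENNReal.ofReal ω := (ENNReal.ofReal_toReal (hWfin a b haA hbB)).symm
  have hσe : S (Ioo d c) = ENNReal.ofReal σ := (ENNReal.ofReal_toReal (hSfin d c hdA hcB)).symm
  have hωpos : 0 < ω := ENNReal.toReal_pos (withDensity_Ioo_ne_zero hw hw0 hab) (hWfin a b haA hbB)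
  have hσpos : 0 < σ := ENNReal.toReal_pos (withDensity_Ioo_ne_zero hs hs0 hdc) (hSfin d c hdA hcB)
  have hKpos : (0 : ℝ) < K := lt_of_lt_of_le one_pos (by exact_mod_cast hK)
  have hLpos : 0 < c - a := by linarith
  have hAreal : ω * σ ^ (p - 1) ≤ 2 * K * (c - a) ^ p := by
    have h1 := hA a d c haA had hdc hcB
    rw [hWad, hσe, hωe, ← ENNReal.ofReal_ofNat 2, ← ENNReal.ofReal_div_of_pos (by norm_num),
      ENNReal.ofReal_rpow_of_pos hσpos, ENNReal.ofReal_rpow_of_pos hLpos,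
      ← ENNReal.ofReal_mul (by positivity), ← ENNReal.ofReal_coe_nnreal,
      ← ENNReal.ofReal_mul (by positivity), ENNReal.ofReal_le_ofReal_iff (by positivity)] at h1
    linarith
  -- With this level, `weakType` for `m = V = S` (where the Hölder hypothesis is an equality) gives
  -- the rise set `W`-mass at most `ω / 4`, less than the mass `ω / 2` of `(d, b)`. Hence some `y`
  -- in `(d, b)` has all its right means up to `c` bounded by `l`, which is what `reverseHolder`
  -- needs.
  set l := (4 * 4 ^ p * K * σ / ω) ^ (1 / p) with hl
  have hlpos : 0 < l := by positivity
  have hlp : l ^ p = 4 * 4 ^ p * K * σ / ω := by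
    rw [hl, ← Real.rpow_mul (by positivity), one_div_mul_cancel hp0.ne', Real.rpow_one]
  have hweak := weakType hp (hA.mono hdA hcB) (m := S.restrict (Ioo d c)) (V := S) (by
    intro y z h1 h2 h3
    rw [hrestr S d c y z h1 h3]
    refine le_of_eq ?_
    conv_lhs => rw [show p = 1 + (p - 1) by ring]
    rw [ENNReal.rpow_add_of_nonneg _ _ zero_le_one hp1.le, ENNReal.rpow_one]) hlpos
  have hex : ∃ y ∈ Ioo d b, y ∉ riseSet (S.restrict (Ioo d c)) l d c := by
    by_contra! hcon
    have h1 : W (Ioo d b) ≤ W (riseSet (S.restrict (Ioo d c)) l d c) := measure_mono hcon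
    have h2 : ENNReal.ofReal l ^ p * W (Ioo d b) ≤ 4 ^ p * K * S (Ioo d c) :=
      le_trans (by gcongr) hweak
    have h4 : (4 : ℝ≥0∞) ^ p = ENNReal.ofReal (4 ^ p) := by
      rw [← ENNReal.ofReal_rpow_of_pos (by norm_num), ENNReal.ofReal_ofNat]
    rw [hWdb, hσe, hωe, ← ENNReal.ofReal_ofNat 2, ← ENNReal.ofReal_div_of_pos (by norm_num),
      ENNReal.ofReal_rpow_of_pos hlpos, h4, ← ENNReal.ofReal_mul (by positivity),
      ← ENNReal.ofReal_coe_nnreal, ← ENNReal.ofReal_mul (by positivity),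
      ← ENNReal.ofReal_mul (by positivity), ENNReal.ofReal_le_ofReal_iff (by positivity),
      hlp] at h2
    have h5 : 4 * 4 ^ p * (K : ℝ) * σ / ω * (ω / 2) = 2 * (4 ^ p * K * σ) := by
      field_simp; ring
    rw [h5] at h2
    have : 0 < 4 ^ p * (K : ℝ) * σ := by positivity
    linarith
  obtain ⟨y, hy, hyn⟩ := hex
  have hyc : y < c := hy.2.trans hbc
  have hyA : A ≤ y := hdA.trans hy.1.le
  have hmean : ∀ z, y < z → z ≤ c → S (Ioo y z) ≤ ENNReal.ofReal (l * (z - y)) := by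
    intro z hz1 hz2
    by_contra! hlt
    refine hyn ⟨⟨hy.1, hyc⟩, z, hz1, hz2, ?_⟩
    rwa [hrestr S d c y z hy.1.le hz2]
  have hRH := reverseHolder hp hw hs hws hβ hβ1 hβK hδ hδ1 hδβ hlpos (hA.mono hyA hcB)
    (hSfin y c hyA hcB) hmean
  have hSr : (volume.withDensity fun x => s x ^ (1 + δ)) (Ioo b c) ≤
      ENNReal.ofReal (2 * (l ^ δ * σ)) := by
    calc _ ≤ (volume.withDensity fun x => s x ^ (1 + δ)) (Ioo y c) :=
          measure_mono (Ioo_subset_Ioo hy.2.le le_rfl)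
      _ ≤ 2 * (ENNReal.ofReal (l ^ δ) * S (Ioo y c)) := hRH
      _ ≤ 2 * (ENNReal.ofReal (l ^ δ) * S (Ioo d c)) := by
          gcongr; exact hy.1.le
      _ = _ := by
          rw [hσe, ENNReal.ofReal_mul (p := 2) (by norm_num), ENNReal.ofReal_ofNat,
            ENNReal.ofReal_mul (by positivity)]
  have hfinal := rpow_bound_of_mul_rpow_le hp hδ hωpos hσpos hLpos
    (by positivity : (0 : ℝ) < 2 * K) (by positivity : (0 : ℝ) < 4 * 4 ^ p * K) hAreal
  have hr : 1 + (p - 1) / (1 + δ) - 1 = (p - 1) / (1 + δ) := by ring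
  rw [hr]
  calc _ ≤ ENNReal.ofReal ω * ENNReal.ofReal (2 * (l ^ δ * σ)) ^ ((p - 1) / (1 + δ)) := by
        rw [hωe]; gcongr
    _ = ENNReal.ofReal (ω * (2 * (l ^ δ * σ)) ^ ((p - 1) / (1 + δ))) := by
        rw [ENNReal.ofReal_rpow_of_pos (by positivity), ← ENNReal.ofReal_mul (by positivity)]
    _ ≤ _ := ENNReal.ofReal_le_ofReal hfinal
    _ = _ := by
        rw [ENNReal.ofReal_mul (by positivity), ENNReal.ofReal_rpow_of_pos hLpos]
        rfl

/-- The one-sided Muckenhoupt condition is open in the exponent, with uniform constants. -/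
theorem exists_improve {p : ℝ} (hp : 1 < p) (K : ℝ≥0) :
    ∃ δ : ℝ, 0 < δ ∧ ∃ K' : ℝ≥0, ∀ w s : ℝ → ℝ≥0∞, Measurable w → Measurable s →
      (∀ x, w x * s x ^ (p - 1) = 1) → ∀ A B : ℝ,
      OneSidedAp p K A B (volume.withDensity w) (volume.withDensity s) →
      (volume.withDensity w) (Ioo A B) ≠ ∞ → (volume.withDensity s) (Ioo A B) ≠ ∞ →
      OneSidedAp (1 + (p - 1) / (1 + δ)) K' A B
        (volume.withDensity w) (volume.withDensity fun x => s x ^ (1 + δ)) := by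
  have hp1 : 0 < p - 1 := by linarith
  set k : ℝ := (K : ℝ) + 1 with hk
  have hkpos : 0 < k := by positivity
  -- Chosen so that `(2 * β) ^ (p - 1) * k ≤ 1 / 4`. Replacing `K` by `K + 1` keeps the constant at
  -- least `1`.
  set β : ℝ := min 1 ((1 / (4 * k)) ^ (1 / (p - 1)) / 2) with hβ
  have hβpos : 0 < β := lt_min one_pos (by positivity)
  have hβK : ENNReal.ofReal (2 * β) ^ (p - 1) * ((K + 1 : ℝ≥0) : ℝ≥0∞) ≤
      ENNReal.ofReal (1 / 4) := by
    rw [ENNReal.ofReal_rpow_of_pos (by positivity), ← ENNReal.ofReal_coe_nnreal,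
      ← ENNReal.ofReal_mul (by positivity)]
    apply ENNReal.ofReal_le_ofReal
    have h1 : 2 * β ≤ (1 / (4 * k)) ^ (1 / (p - 1)) := by
      have := min_le_right (1 : ℝ) ((1 / (4 * k)) ^ (1 / (p - 1)) / 2)
      rw [← hβ] at this
      linarith
    have h2 : (2 * β) ^ (p - 1) ≤ 1 / (4 * k) := by
      refine (Real.rpow_le_rpow (by positivity) h1 hp1.le).trans (le_of_eq ?_)
      rw [← Real.rpow_mul (by positivity), one_div_mul_cancel hp1.ne', Real.rpow_one]
    have h3 : ((K + 1 : ℝ≥0) : ℝ) = k := by rw [hk]; push_cast; rfl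
    rw [h3]
    calc (2 * β) ^ (p - 1) * k ≤ 1 / (4 * k) * k := by gcongr
      _ = 1 / 4 := by field_simp
  have hβ1 : β ≤ 1 := min_le_left _ _
  have H := fun (w s : ℝ → ℝ≥0∞) (hw : Measurable w) (hs : Measurable s)
      (hws : ∀ x, w x * s x ^ (p - 1) = 1) (A B : ℝ)
      (hA : OneSidedAp p K A B (volume.withDensity w) (volume.withDensity s)) =>
    OneSidedAp.improve (K := K + 1) hp (by simp) hw hs hws hβpos hβ1 hβK
      (δ := β ^ 2 / 8) (by positivity) (by nlinarith) (by linarith) (A := A) (B := B)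
      fun a b c h1 h2 h3 h4 =>
        (hA a b c h1 h2 h3 h4).trans (by gcongr; simp)
  exact ⟨β ^ 2 / 8, by positivity, _, H⟩

/-! ### Weak type inequalities with an improved exponent -/

/-- Hölder's inequality with weights `1 / r` and `(r - 1) / r`, since duality gives `g = (g ^ r * w)
^ (1 / r) * s ^ ((r - 1) / r)`. -/
theorem lintegral_rpow_le_mul_rpow {r : ℝ} (hr : 1 < r) {w s g : ℝ → ℝ≥0∞} (hw : Measurable w)
    (hs : Measurable s) (hg : Measurable g) (hws : ∀ x, w x * s x ^ (r - 1) = 1) (I : Set ℝ) :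
    (∫⁻ x in I, g x) ^ r ≤ (∫⁻ x in I, g x ^ r * w x) * (∫⁻ x in I, s x) ^ (r - 1) := by
  have hr0 : 0 < r := by linarith
  have h := ENNReal.lintegral_mul_norm_pow_le (μ := volume.restrict I)
    (f := fun x => g x ^ r * w x) (g := s) ((hg.pow_const r).mul hw).aemeasurable hs.aemeasurable
    (p := 1 / r) (q := (r - 1) / r) (by positivity) (div_nonneg (by linarith) hr0.le)
    (by field_simp; ring)
  have hpt : ∀ x, (g x ^ r * w x) ^ (1 / r) * s x ^ ((r - 1) / r) = g x := by
    intro x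
    rw [show (r - 1) / r = (r - 1) * (1 / r) by ring, ENNReal.rpow_mul,
      ← ENNReal.mul_rpow_of_nonneg _ _ (by positivity), mul_assoc, hws, mul_one,
      ← ENNReal.rpow_mul, mul_one_div_cancel hr0.ne', ENNReal.rpow_one]
  simp only [hpt] at h
  calc _ ≤ _ := ENNReal.rpow_le_rpow h hr0.le
    _ = _ := by
      rw [ENNReal.mul_rpow_of_nonneg _ _ hr0.le, ← ENNReal.rpow_mul, ← ENNReal.rpow_mul,
        one_div_mul_cancel hr0.ne', div_mul_cancel₀ _ hr0.ne', ENNReal.rpow_one]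

/-- Local integrability is not assumed of weights. It is hidden in the condition: the product is
finite, so one factor is finite as soon as the other is nonzero. -/
theorem OneSidedAp.right_ne_top {p : ℝ} (hp : 1 < p) {K : ℝ≥0} {A B a b c : ℝ} {W S : Measure ℝ}
    (h : OneSidedAp p K A B W S) (hA : A ≤ a) (hab : a < b) (hbc : b < c) (hB : c ≤ B)
    (h0 : W (Ioo a b) ≠ 0) : S (Ioo b c) ≠ ∞ := by
  intro ht
  have h1 := h a b c hA hab hbc hB
  rw [ht, ENNReal.top_rpow_of_pos (by linarith), ENNReal.mul_top h0, top_le_iff] at h1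
  exact ENNReal.mul_ne_top ENNReal.coe_ne_top
    (ENNReal.rpow_ne_top_of_nonneg (by linarith) ENNReal.ofReal_ne_top) h1

theorem OneSidedAp.left_ne_top {p : ℝ} (hp : 1 < p) {K : ℝ≥0} {A B a b c : ℝ} {W S : Measure ℝ}
    (h : OneSidedAp p K A B W S) (hA : A ≤ a) (hab : a < b) (hbc : b < c) (hB : c ≤ B)
    (h0 : S (Ioo b c) ≠ 0) : W (Ioo a b) ≠ ∞ := by
  intro ht
  have h1 := h a b c hA hab hbc hB
  have h2 : S (Ioo b c) ^ (p - 1) ≠ 0 := by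
    rw [Ne, ENNReal.rpow_eq_zero_iff_of_pos (by linarith)]; exact h0
  rw [ht, ENNReal.top_mul h2, top_le_iff] at h1
  exact ENNReal.mul_ne_top ENNReal.coe_ne_top
    (ENNReal.rpow_ne_top_of_nonneg (by linarith) ENNReal.ofReal_ne_top) h1

/-- The weak type inequality with an exponent smaller than that of the weight class, on a bounded
interval and for averages to the right. -/
theorem exists_weakType_right {p : ℝ} (hp : 1 < p) (K : ℝ≥0) :
    ∃ r : ℝ, 1 < r ∧ r < p ∧ ∃ C : ℝ≥0, ∀ w s : ℝ → ℝ≥0∞, Measurable w → Measurable s →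
      (∀ x, w x * s x ^ (p - 1) = 1) → ∀ A₀ A B : ℝ, A₀ < A → A < B →
      OneSidedAp p K A₀ B (volume.withDensity w) (volume.withDensity s) →
      (volume.withDensity w) (Ioo A₀ B) ≠ ∞ → (volume.withDensity s) (Ioo A₀ B) ≠ ∞ →
      ∀ g : ℝ → ℝ≥0∞, Measurable g → ∀ l : ℝ, 0 < l →
      ENNReal.ofReal l ^ r * (volume.withDensity w) {x | x ∈ Ioo A B ∧ ∃ y, x < y ∧ y ≤ B ∧
          ENNReal.ofReal (l * (y - x)) < ∫⁻ t in Ioo x y, g t} ≤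
        C * ∫⁻ x in Ioo A B, g x ^ r * w x := by
  have hp1 : 0 < p - 1 := by linarith
  obtain ⟨δ, hδ, K', hK'⟩ := exists_improve hp K
  set r := 1 + (p - 1) / (1 + δ) with hr
  have hr1 : 1 < r := by rw [hr]; have : 0 < (p - 1) / (1 + δ) := by positivity
                         linarith
  have hrp : r < p := by
    have : (p - 1) / (1 + δ) < p - 1 := div_lt_self hp1 (by linarith)
    rw [hr]; linarith
  -- The `+ 1` keeps the constant nonzero, so that the inequality is trivial when the integral on
  -- the right is infinite.
  refine ⟨r, hr1, hrp, 4 ^ r * (K' + 1), ?_⟩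
  intro w s hw hs hws A₀ A B hA₀ hAB hAp hWfin hSfin g hg l hl
  have hA := hK' w s hw hs hws A₀ B hAp hWfin hSfin
  have hw0 : ∀ x, w x ≠ 0 := fun x => (ne_zero_and_ne_top_of_mul_rpow hp1 (hws x)).1
  -- Since `(1 + δ) * (r - 1) = p - 1`, the function `s ^ (1 + δ)` is the dual weight of `w` for the
  -- exponent `r`.
  have hws' : ∀ x, w x * (s x ^ (1 + δ)) ^ (r - 1) = 1 := by
    intro x
    rw [← ENNReal.rpow_mul, ← hws x]
    congr 2
    rw [hr]; field_simp; ring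
  have hsm : Measurable fun x => s x ^ (1 + δ) := hs.pow_const _
  set W := volume.withDensity w with hW
  set S := volume.withDensity fun x => s x ^ (1 + δ) with hS
  -- The margin `(A₀, A)`, of positive `W`-mass, forces the new dual weight to be integrable on `(A,
  -- B)`. Hölder's inequality then makes `g` integrable there.
  have hSr : S (Ioo A B) ≠ ∞ :=
    hA.right_ne_top hr1 le_rfl hA₀ hAB le_rfl (withDensity_Ioo_ne_zero hw hw0 hA₀)
  have hC : ((4 ^ r * (K' + 1) : ℝ≥0) : ℝ≥0∞) = 4 ^ r * (K' + 1) := by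
    push_cast
    rw [ENNReal.coe_rpow_of_nonneg _ (by linarith)]
    rfl
  rcases eq_or_ne (∫⁻ x in Ioo A B, g x ^ r * w x) ∞ with hV | hV
  · rw [hV, ENNReal.mul_top]
    · exact le_top
    · rw [hC]; simp
  have hgr : Measurable fun x => g x ^ r * w x := (hg.pow_const r).mul hw
  have hGfin : (volume.withDensity g) (Ioo A B) ≠ ∞ := by
    rw [withDensity_apply _ measurableSet_Ioo]
    intro ht
    have h1 := lintegral_rpow_le_mul_rpow hr1 hw hsm hg hws' (Ioo A B)
    rw [ht, ENNReal.top_rpow_of_pos (by linarith), top_le_iff] at h1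
    rw [hS, withDensity_apply _ measurableSet_Ioo] at hSr
    exact ENNReal.mul_ne_top hV (ENNReal.rpow_ne_top_of_nonneg (by linarith) hSr) h1
  have : Fact ((volume.withDensity g) (Ioo A B) < ∞) := ⟨hGfin.lt_top⟩
  have hrestr : ∀ x y : ℝ, A ≤ x → y ≤ B →
      (volume.withDensity g).restrict (Ioo A B) (Ioo x y) = ∫⁻ t in Ioo x y, g t := by
    intro x y ha hb
    rw [Measure.restrict_apply measurableSet_Ioo,
      inter_eq_self_of_subset_left (Ioo_subset_Ioo ha hb), withDensity_apply _ measurableSet_Ioo]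
  have hweak := weakType hr1 (hA.mono hA₀.le le_rfl)
    (m := (volume.withDensity g).restrict (Ioo A B))
    (V := volume.withDensity fun x => g x ^ r * w x) (by
      intro y z h1 h2 h3
      rw [hrestr y z h1 h3, withDensity_apply _ measurableSet_Ioo, hS,
        withDensity_apply _ measurableSet_Ioo]
      exact lintegral_rpow_le_mul_rpow hr1 hw hsm hg hws' _) hl
  rw [withDensity_apply _ measurableSet_Ioo] at hweak
  refine le_trans ?_ (hweak.trans ?_)
  · refine mul_le_mul_right (measure_mono ?_) _
    rintro x ⟨hx, y, hxy, hyB, hlt⟩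
    refine ⟨hx, y, hxy, hyB, ?_⟩
    rwa [hrestr x y hx.1.le hyB]
  · rw [hC]
    gcongr
    simp

theorem setLIntegral_comp_neg (f : ℝ → ℝ≥0∞) (T : Set ℝ) :
    ∫⁻ x in Neg.neg ⁻¹' T, f (-x) = ∫⁻ x in T, f x :=
  (Measure.measurePreserving_neg (volume : Measure ℝ)).setLIntegral_comp_preimage_emb
    (MeasurableEquiv.neg ℝ).measurableEmbedding f T

theorem setLIntegral_Ioo_comp_neg (f : ℝ → ℝ≥0∞) (a b : ℝ) :
    ∫⁻ x in Ioo a b, f (-x) = ∫⁻ x in Ioo (-b) (-a), f x := by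
  rw [← setLIntegral_comp_neg f (Ioo (-b) (-a))]
  congr 2
  ext x; simp only [mem_Ioo, mem_preimage]
  constructor <;> rintro ⟨h1, h2⟩ <;> constructor <;> linarith

/-- The weak type inequality for averages to the left, obtained by reflection. -/
theorem exists_weakType_left {p : ℝ} (hp : 1 < p) (K : ℝ≥0) :
    ∃ r : ℝ, 1 < r ∧ r < p ∧ ∃ C : ℝ≥0, ∀ w s : ℝ → ℝ≥0∞, Measurable w → Measurable s →
      (∀ x, w x * s x ^ (p - 1) = 1) → ∀ A B B₀ : ℝ, A < B → B < B₀ →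
      (∀ a b c, A ≤ a → a < b → b < c → c ≤ B₀ → (∫⁻ x in Ioo b c, w x) *
        (∫⁻ x in Ioo a b, s x) ^ (p - 1) ≤ K * ENNReal.ofReal (c - a) ^ p) →
      (∫⁻ x in Ioo A B₀, w x) ≠ ∞ → (∫⁻ x in Ioo A B₀, s x) ≠ ∞ →
      ∀ g : ℝ → ℝ≥0∞, Measurable g → ∀ l : ℝ, 0 < l →
      ENNReal.ofReal l ^ r * (volume.withDensity w) {x | x ∈ Ioo A B ∧ ∃ y, y < x ∧ A ≤ y ∧
          ENNReal.ofReal (l * (x - y)) < ∫⁻ t in Ioo y x, g t} ≤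
        C * ∫⁻ x in Ioo A B, g x ^ r * w x := by
  obtain ⟨r, hr1, hrp, C, hC⟩ := exists_weakType_right hp K
  refine ⟨r, hr1, hrp, C, ?_⟩
  intro w s hw hs hws A B B₀ hAB hBB hA hWfin hSfin g hg l hl
  have h := hC (fun x => w (-x)) (fun x => s (-x)) (hw.comp measurable_neg)
    (hs.comp measurable_neg) (fun x => hws (-x)) (-B₀) (-B) (-A) (by linarith) (by linarith)
    (by
      intro a b c h1 h2 h3 h4
      rw [withDensity_apply _ measurableSet_Ioo, withDensity_apply _ measurableSet_Ioo,
        setLIntegral_Ioo_comp_neg, setLIntegral_Ioo_comp_neg]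
      have := hA (-c) (-b) (-a) (by linarith) (by linarith) (by linarith) (by linarith)
      rwa [show -a - -c = c - a by ring] at this)
    (by rw [withDensity_apply _ measurableSet_Ioo, setLIntegral_Ioo_comp_neg]; simpa using hWfin)
    (by rw [withDensity_apply _ measurableSet_Ioo, setLIntegral_Ioo_comp_neg]; simpa using hSfin)
    (fun x => g (-x)) (hg.comp measurable_neg) l hl
  have e1 := setLIntegral_Ioo_comp_neg (fun x => g x ^ r * w x) (-B) (-A)
  rw [e1, neg_neg, neg_neg, withDensity_apply'] at h
  refine le_trans (mul_le_mul_right (le_of_eq ?_) _) h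
  rw [withDensity_apply', ← setLIntegral_comp_neg]
  congr 2
  ext x
  simp only [mem_preimage, mem_ofPred_eq, mem_Ioo]
  constructor
  · rintro ⟨⟨h1, h2⟩, y, h3, h4, h5⟩
    refine ⟨⟨by linarith, by linarith⟩, -y, by linarith, by linarith, ?_⟩
    rw [setLIntegral_Ioo_comp_neg, neg_neg]
    rwa [show -y - x = -x - y by ring]
  · rintro ⟨⟨h1, h2⟩, y, h3, h4, h5⟩
    refine ⟨⟨by linarith, by linarith⟩, -y, by linarith, by linarith, ?_⟩
    rw [setLIntegral_Ioo_comp_neg] at h5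
    rwa [show -x - -y = y - x by ring]

/-! ### The half-line -/

/-- The right maximal function on the half-line, for nonnegative functions. -/
noncomputable def maxRight (g : ℝ → ℝ≥0∞) : ℝ → ℝ≥0∞ :=
  (Ioi 0).indicator fun t =>
    ⨆ h ∈ Ioi (0 : ℝ), (∫⁻ s in Ioo t (t + h), (Ioi 0).indicator g s) / ENNReal.ofReal h

/-- The left maximal function on the half-line, for nonnegative functions. -/
noncomputable def maxLeft (g : ℝ → ℝ≥0∞) : ℝ → ℝ≥0∞ :=
  (Ioi 0).indicator fun t =>
    ⨆ h ∈ Ioi (0 : ℝ), (∫⁻ s in Ioo (t - h) t, (Ioi 0).indicator g s) / ENNReal.ofReal h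

/-- A weight has a measurable version, positive and finite everywhere, together with its dual. -/
theorem IsWeight.exists_density {w : ℝ → ℝ} (hw : IsWeight w) {p : ℝ} (hp : 1 < p) :
    ∃ v s : ℝ → ℝ≥0∞, Measurable v ∧ Measurable s ∧ (∀ x, v x * s x ^ (p - 1) = 1) ∧
      (∀ x, v x ≠ 0) ∧ (∀ x, s x ≠ 0) ∧ (fun x => ENNReal.ofReal (w x)) =ᵐ[vol] v ∧
      (fun x => ENNReal.ofReal (w x ^ (1 - p / (p - 1)))) =ᵐ[vol] s := by
  have hp1 : 0 < p - 1 := by linarith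
  obtain ⟨hwm, hwpos⟩ := hw
  set u := hwm.mk w with hu
  have hum : Measurable u := hwm.measurable_mk
  -- Changing the values on a null set makes the duality identity hold at every point.
  set u' : ℝ → ℝ := fun x => if 0 < u x then u x else 1 with hu'
  have hu'm : Measurable u' :=
    Measurable.ite (measurableSet_lt measurable_const hum) hum measurable_const
  have hu'pos : ∀ x, 0 < u' x := by
    intro x
    by_cases h : 0 < u x <;> simp [hu', h]
  have hae : w =ᵐ[vol] u' := by
    filter_upwards [hwm.ae_eq_mk, hwpos] with x hx hx0
    have : 0 < u x := by rw [hu, ← hx]; exact hx0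
    have h2 : u' x = u x := if_pos this
    rw [h2, hx]
  have hvm : Measurable fun x => ENNReal.ofReal (u' x) := hu'm.ennreal_ofReal
  have hws : ∀ x, ENNReal.ofReal (u' x) *
      (ENNReal.ofReal (u' x) ^ (1 - p / (p - 1))) ^ (p - 1) = 1 := by
    intro x
    have h0 : ENNReal.ofReal (u' x) ≠ 0 := by simpa using hu'pos x
    rw [← ENNReal.rpow_mul, show (1 - p / (p - 1)) * (p - 1) = -1 by field_simp; ring,
      ENNReal.rpow_neg_one, ENNReal.mul_inv_cancel h0 ENNReal.ofReal_ne_top]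
  refine ⟨fun x => ENNReal.ofReal (u' x), fun x => ENNReal.ofReal (u' x) ^ (1 - p / (p - 1)),
    hvm, hvm.pow_const _, hws, fun x => (ne_zero_and_ne_top_of_mul_rpow hp1 (hws x)).1,
    fun x => (ne_zero_and_ne_top_of_mul_rpow hp1 (hws x)).2.2.1, ?_, ?_⟩
  · filter_upwards [hae] with x hx
    rw [hx]
  · filter_upwards [hae] with x hx
    rw [hx, ENNReal.ofReal_rpow_of_pos (hu'pos x)]

theorem setLIntegral_congr_of_ae_vol {f g : ℝ → ℝ≥0∞} (h : f =ᵐ[vol] g) {T : Set ℝ}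
    (hT : T ⊆ Ioi 0) : ∫⁻ x in T, f x = ∫⁻ x in T, g x := by
  refine lintegral_congr_ae (ae_mono ?_ h)
  exact Measure.restrict_mono hT le_rfl

theorem withDensity_vol_apply (v : ℝ → ℝ≥0∞) {T : Set ℝ} (hT : T ⊆ Ioi 0) :
    (vol.withDensity v) T = (volume.withDensity v) T := by
  rw [vol, ← restrict_withDensity measurableSet_Ioi, Measure.restrict_apply' measurableSet_Ioi,
    inter_eq_self_of_subset_left hT]

/-- Passage from bounded intervals to the half-line by continuity from below; the constant must not
depend on the interval. -/
theorem withDensity_le_of_subset_iUnion {v : ℝ → ℝ≥0∞} (hv : Measurable v) {r : ℝ} {C : ℝ≥0}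
    {g : ℝ → ℝ≥0∞} (hg : Measurable g) {L : ℝ≥0∞} {T : Set ℝ} (O : ℕ → Set ℝ) (hO : Monotone O)
    (hO0 : ∀ n, O n ⊆ Ioi 0)
    (hT : T ⊆ ⋃ n, O n) (A B : ℕ → ℝ) (hA : ∀ n, 0 ≤ A n)
    (h : ∀ n, L * (volume.withDensity v) (O n) ≤ C * ∫⁻ x in Ioo (A n) (B n), g x ^ r * v x) :
    L * (vol.withDensity v) T ≤ C * ∫⁻ x, g x ^ r ∂(vol.withDensity v) := by
  have hint : ∫⁻ x, g x ^ r ∂(vol.withDensity v) = ∫⁻ x in Ioi 0, g x ^ r * v x := by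
    rw [lintegral_withDensity_eq_lintegral_mul _ hv (hg.pow_const r)]
    simp only [Pi.mul_apply, mul_comm, vol]
  rw [hint]
  calc L * (vol.withDensity v) T ≤ L * (vol.withDensity v) (⋃ n, O n) := by gcongr
    _ = ⨆ n, L * (vol.withDensity v) (O n) := by rw [hO.measure_iUnion, ENNReal.mul_iSup]
    _ ≤ _ := by
        refine iSup_le fun n => ?_
        rw [withDensity_vol_apply v (hO0 n)]
        refine (h n).trans ?_
        gcongr
        exact fun x hx => lt_of_le_of_lt (hA n) hx.1

/-- The weak type inequality for the right maximal function on the half-line. -/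
theorem MemApPlus.exists_weakType {p : ℝ} (hp : 1 < p) {w : ℝ → ℝ} (hw : MemApPlus p w) :
    ∃ r : ℝ, 1 < r ∧ r < p ∧ ∃ C : ℝ≥0, ∀ g : ℝ → ℝ≥0∞, Measurable g → ∀ l : ℝ, 0 < l →
      ENNReal.ofReal l ^ r * weightMeasure w {t | ENNReal.ofReal l < maxRight g t} ≤
        C * ∫⁻ x, g x ^ r ∂(weightMeasure w) := by
  obtain ⟨v, s, hv, hs, hvs, hv0, hs0, hwv, hws⟩ := hw.1.exists_density hp
  have hconst := hw.2
  have hA : ∀ B, OneSidedAp p (apPlusConst p w).toNNReal 0 B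
      (volume.withDensity v) (volume.withDensity s) := by
    intro B a b c ha hab hbc _
    have hsub : ∀ x y, 0 ≤ x → Ioo x y ⊆ Ioi (0 : ℝ) := fun x y hx z hz => hx.trans_lt hz.1
    rw [withDensity_apply _ measurableSet_Ioo, withDensity_apply _ measurableSet_Ioo,
      ← setLIntegral_congr_of_ae_vol hwv (hsub _ _ ha),
      ← setLIntegral_congr_of_ae_vol hws (hsub _ _ (ha.trans hab.le)),
      ENNReal.coe_toNNReal hconst.ne, ENNReal.ofReal_rpow_of_pos (by linarith)]
    have h0 : ENNReal.ofReal ((c - a) ^ p) ≠ 0 := by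
      simpa using Real.rpow_pos_of_pos (by linarith) p
    rw [← ENNReal.div_le_iff_le_mul (Or.inl h0) (Or.inl ENNReal.ofReal_ne_top)]
    unfold apPlusConst
    exact le_iSup_of_le a <| le_iSup_of_le b <| le_iSup_of_le c <| le_iSup_of_le ha <|
      le_iSup_of_le hab <| le_iSup_of_le hbc le_rfl
  obtain ⟨r, hr1, hrp, C, hC⟩ := exists_weakType_right hp (apPlusConst p w).toNNReal
  refine ⟨r, hr1, hrp, C, fun g hg l hl => ?_⟩
  have hμ : weightMeasure w = vol.withDensity v := withDensity_congr_ae hwv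
  rw [hμ]
  set A : ℕ → ℝ := fun n => 1 / ((n : ℝ) + 1) with hAdef
  set B : ℕ → ℝ := fun n => (n : ℝ) + 2 with hBdef
  have hApos : ∀ n, 0 < A n := fun n => by positivity
  have hA1 : ∀ n, A n ≤ 1 := fun n => by
    rw [hAdef]; exact (div_le_one (by positivity)).2 (by linarith [n.cast_nonneg (α := ℝ)])
  have hB1 : ∀ n, 1 < B n := fun n => by rw [hBdef]; linarith [n.cast_nonneg (α := ℝ)]
  refine withDensity_le_of_subset_iUnion hv hg
    (fun n => {x | x ∈ Ioo (A n) (B n) ∧ ∃ y, x < y ∧ y ≤ B n ∧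
      ENNReal.ofReal (l * (y - x)) < ∫⁻ t in Ioo x y, g t}) ?_
    (fun n x hx => (hApos n).trans hx.1.1) ?_ A B (fun n => (hApos n).le) ?_
  · rintro m n hmn x ⟨hx, y, h1, h2, h3⟩
    have hmn' : (m : ℝ) ≤ n := by exact_mod_cast hmn
    have hBmn : B m ≤ B n := by rw [hBdef]; dsimp only; linarith
    have hAmn : A n ≤ A m := by rw [hAdef]; dsimp only; gcongr
    exact ⟨⟨hAmn.trans_lt hx.1, hx.2.trans_le hBmn⟩, y, h1, h2.trans hBmn, h3⟩
  · intro t ht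
    have ht' : ENNReal.ofReal l < maxRight g t := ht
    have ht0 : 0 < t := by
      by_contra hcon
      rw [maxRight, indicator_of_notMem (by simpa using hcon)] at ht'
      exact not_lt_zero ht'
    rw [maxRight, indicator_of_mem (by simpa using ht0)] at ht'
    simp only [lt_iSup_iff, mem_Ioi] at ht'
    obtain ⟨h, hh, hlt⟩ := ht'
    rw [ENNReal.lt_div_iff_mul_lt (Or.inl (by simpa using hh)) (Or.inl ENNReal.ofReal_ne_top),
      ← ENNReal.ofReal_mul hl.le] at hlt
    obtain ⟨n, hn⟩ := exists_nat_ge (max (t + h) (1 / t))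
    have hn1 : t + h ≤ n := (le_max_left _ _).trans hn
    have hn2 : 1 / t ≤ n := (le_max_right _ _).trans hn
    refine mem_iUnion.2 ⟨n, ⟨?_, ?_⟩, t + h, by linarith, ?_, ?_⟩
    · rw [hAdef]; dsimp only
      rw [div_lt_iff₀ (by positivity)]
      rw [div_le_iff₀ ht0] at hn2
      nlinarith
    · rw [hBdef]; dsimp only; linarith
    · rw [hBdef]; dsimp only; linarith
    · rw [add_sub_cancel_left]
      refine hlt.trans_le (setLIntegral_mono' measurableSet_Ioo fun x _ => ?_)
      exact indicator_le_self _ _ _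
  · intro n
    -- The two halves of `(0, A n)` are used separately: `(0, A n / 2)` makes `s` integrable to its
    -- right, and `(A n / 2, A n)` is the margin of `exists_weakType_right`. Finiteness of the
    -- `v`-mass comes from testing against `(B n, B n + 1)`.
    have hA0 : A n / 2 < A n := half_lt_self (hApos n)
    refine hC v s hv hs hvs (A n / 2) (A n) (B n) hA0 ((hA1 n).trans_lt (hB1 n))
      ((hA (B n)).mono (half_pos (hApos n)).le le_rfl) ?_ ?_ g hg l hl
    · exact (hA (B n + 1)).left_ne_top hp (half_pos (hApos n)).le (by linarith [hA1 n, hB1 n])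
        (lt_add_one _) le_rfl (withDensity_Ioo_ne_zero hs hs0 (lt_add_one _))
    · exact (hA (B n)).right_ne_top hp le_rfl (half_pos (hApos n)) (by linarith [hA1 n, hB1 n])
        le_rfl (withDensity_Ioo_ne_zero hv hv0 (half_pos (hApos n)))

/-- The weak type inequality for the left maximal function on the half-line. -/
theorem MemApMinus.exists_weakType {p : ℝ} (hp : 1 < p) {w : ℝ → ℝ} (hw : MemApMinus p w) :
    ∃ r : ℝ, 1 < r ∧ r < p ∧ ∃ C : ℝ≥0, ∀ g : ℝ → ℝ≥0∞, Measurable g → ∀ l : ℝ, 0 < l →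
      ENNReal.ofReal l ^ r * weightMeasure w {t | ENNReal.ofReal l < maxLeft g t} ≤
        C * ∫⁻ x, g x ^ r ∂(weightMeasure w) := by
  obtain ⟨v, s, hv, hs, hvs, hv0, hs0, hwv, hws⟩ := hw.1.exists_density hp
  have hconst := hw.2
  set K := (apMinusConst p w).toNNReal with hK
  have hA : ∀ a b c, 0 ≤ a → a < b → b < c → (∫⁻ x in Ioo b c, v x) *
        (∫⁻ x in Ioo a b, s x) ^ (p - 1) ≤ K * ENNReal.ofReal (c - a) ^ p := by
    intro a b c ha hab hbc
    have hsub : ∀ x y, 0 ≤ x → Ioo x y ⊆ Ioi (0 : ℝ) := fun x y hx z hz => hx.trans_lt hz.1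
    rw [← setLIntegral_congr_of_ae_vol hws (hsub _ _ ha),
      ← setLIntegral_congr_of_ae_vol hwv (hsub _ _ (ha.trans hab.le)),
      ENNReal.coe_toNNReal hconst.ne, ENNReal.ofReal_rpow_of_pos (by linarith)]
    have h0 : ENNReal.ofReal ((c - a) ^ p) ≠ 0 := by
      simpa using Real.rpow_pos_of_pos (by linarith) p
    rw [← ENNReal.div_le_iff_le_mul (Or.inl h0) (Or.inl ENNReal.ofReal_ne_top)]
    unfold apMinusConst
    exact le_iSup_of_le a <| le_iSup_of_le b <| le_iSup_of_le c <| le_iSup_of_le ha <|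
      le_iSup_of_le hab <| le_iSup_of_le hbc le_rfl
  have hKfin : ∀ x : ℝ, (K : ℝ≥0∞) * ENNReal.ofReal x ^ p ≠ ∞ := fun x =>
    ENNReal.mul_ne_top ENNReal.coe_ne_top
      (ENNReal.rpow_ne_top_of_nonneg (by linarith) ENNReal.ofReal_ne_top)
  have hpos : ∀ f : ℝ → ℝ≥0∞, Measurable f → (∀ x, f x ≠ 0) → ∀ a b : ℝ, a < b →
      (∫⁻ x in Ioo a b, f x) ≠ 0 := fun f hf h0 a b hab => by
    rw [← withDensity_apply _ measurableSet_Ioo]; exact withDensity_Ioo_ne_zero hf h0 hab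
  have hvfin : ∀ b c, 0 < b → b < c → (∫⁻ x in Ioo b c, v x) ≠ ∞ := by
    intro b c hb hbc ht
    have h1 := hA 0 b c le_rfl hb hbc
    have h2 : (∫⁻ x in Ioo 0 b, s x) ^ (p - 1) ≠ 0 := by
      rw [Ne, ENNReal.rpow_eq_zero_iff_of_pos (by linarith)]; exact hpos s hs hs0 0 b hb
    rw [ht, ENNReal.top_mul h2, top_le_iff] at h1
    exact hKfin _ h1
  have hsfin : ∀ a b, 0 ≤ a → a < b → (∫⁻ x in Ioo a b, s x) ≠ ∞ := by
    intro a b ha hab ht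
    have h1 := hA a b (b + 1) ha hab (lt_add_one b)
    rw [ht, ENNReal.top_rpow_of_pos (by linarith),
      ENNReal.mul_top (hpos v hv hv0 _ _ (lt_add_one b)), top_le_iff] at h1
    exact hKfin _ h1
  obtain ⟨r, hr1, hrp, C, hC⟩ := exists_weakType_left hp K
  refine ⟨r, hr1, hrp, C, fun g hg l hl => ?_⟩
  have hμ : weightMeasure w = vol.withDensity v := withDensity_congr_ae hwv
  rw [hμ]
  set A : ℕ → ℝ := fun n => 1 / ((n : ℝ) + 1) with hAdef
  set B : ℕ → ℝ := fun n => (n : ℝ) + 2 with hBdef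
  have hApos : ∀ n, 0 < A n := fun n => by positivity
  have hA1 : ∀ n, A n ≤ 1 := fun n => by
    rw [hAdef]; exact (div_le_one (by positivity)).2 (by linarith [n.cast_nonneg (α := ℝ)])
  have hB1 : ∀ n, 1 < B n := fun n => by rw [hBdef]; linarith [n.cast_nonneg (α := ℝ)]
  refine withDensity_le_of_subset_iUnion hv hg
    (fun n => {x | x ∈ Ioo (A n) (B n) ∧ ∃ y, y < x ∧ A n ≤ y ∧
      ENNReal.ofReal (l * (x - y)) < ∫⁻ t in Ioo y x, g t}) ?_
    (fun n x hx => (hApos n).trans hx.1.1) ?_ A B (fun n => (hApos n).le) ?_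
  · rintro m n hmn x ⟨hx, y, h1, h2, h3⟩
    have hmn' : (m : ℝ) ≤ n := by exact_mod_cast hmn
    have hBmn : B m ≤ B n := by rw [hBdef]; dsimp only; linarith
    have hAmn : A n ≤ A m := by rw [hAdef]; dsimp only; gcongr
    exact ⟨⟨hAmn.trans_lt hx.1, hx.2.trans_le hBmn⟩, y, h1, hAmn.trans h2, h3⟩
  · intro t ht
    have ht' : ENNReal.ofReal l < maxLeft g t := ht
    have ht0 : 0 < t := by
      by_contra hcon
      rw [maxLeft, indicator_of_notMem (by simpa using hcon)] at ht'
      exact not_lt_zero ht'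
    rw [maxLeft, indicator_of_mem (by simpa using ht0)] at ht'
    simp only [lt_iSup_iff, mem_Ioi] at ht'
    obtain ⟨h, hh, hlt⟩ := ht'
    rw [ENNReal.lt_div_iff_mul_lt (Or.inl (by simpa using hh)) (Or.inl ENNReal.ofReal_ne_top),
      ← ENNReal.ofReal_mul hl.le] at hlt
    -- A window reaching past `0` sees only `g` on `(0, t)`. By monotone convergence the strict
    -- inequality survives on `(t / (n + 2), t)` for some `n`, and the shorter length only helps.
    have hy : ∃ y, 0 < y ∧ y < t ∧ ENNReal.ofReal (l * (t - y)) < ∫⁻ x in Ioo y t, g x := by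
      rcases lt_or_ge 0 (t - h) with hth | hth
      · refine ⟨t - h, hth, by linarith, ?_⟩
        rw [sub_sub_cancel]
        refine hlt.trans_le (setLIntegral_mono' measurableSet_Ioo fun x _ => ?_)
        exact indicator_le_self _ _ _
      · have hI : ∫⁻ x in Ioo (t - h) t, (Ioi 0).indicator g x = ∫⁻ x in Ioo 0 t, g x := by
          rw [lintegral_indicator measurableSet_Ioi, Measure.restrict_restrict measurableSet_Ioi]
          congr 2
          ext x; simp only [mem_inter_iff, mem_Ioi, mem_Ioo]
          constructor
          · rintro ⟨h1, h2, h3⟩; exact ⟨h1, h3⟩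
          · rintro ⟨h1, h3⟩; exact ⟨h1, by linarith, h3⟩
        have hU : Ioo 0 t = ⋃ n : ℕ, Ioo (t / (n + 2)) t := by
          ext x; simp only [mem_Ioo, mem_iUnion]
          constructor
          · rintro ⟨h1, h2⟩
            obtain ⟨n, hn⟩ := exists_nat_ge (t / x)
            refine ⟨n, ?_, h2⟩
            rw [div_le_iff₀ h1] at hn
            rw [div_lt_iff₀ (by positivity)]
            nlinarith
          · rintro ⟨n, h1, h2⟩
            exact ⟨lt_trans (by positivity) h1, h2⟩
        have hmono : Monotone fun n : ℕ => Ioo (t / ((n : ℝ) + 2)) t := by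
          intro m n hmn
          have hmn' : (m : ℝ) ≤ n := by exact_mod_cast hmn
          refine Ioo_subset_Ioo ?_ le_rfl
          gcongr
        rw [hI, ← withDensity_apply _ measurableSet_Ioo, hU, hmono.measure_iUnion,
          lt_iSup_iff] at hlt
        obtain ⟨n, hn⟩ := hlt
        rw [withDensity_apply _ measurableSet_Ioo] at hn
        have hn0 : 0 < t / ((n : ℝ) + 2) := by positivity
        refine ⟨t / (n + 2), hn0, ?_, lt_of_le_of_lt ?_ hn⟩
        · exact div_lt_self ht0 (by linarith [n.cast_nonneg (α := ℝ)])
        · exact ENNReal.ofReal_le_ofReal (mul_le_mul_of_nonneg_left (by linarith) hl.le)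
    obtain ⟨y, hy0, hyt, hlt⟩ := hy
    obtain ⟨n, hn⟩ := exists_nat_ge (max t (1 / y))
    have hn1 : t ≤ n := (le_max_left _ _).trans hn
    have hn2 : 1 / y ≤ n := (le_max_right _ _).trans hn
    have hAy : A n < y := by
      rw [hAdef]; dsimp only
      rw [div_lt_iff₀ (by positivity)]
      rw [div_le_iff₀ hy0] at hn2
      nlinarith
    refine mem_iUnion.2 ⟨n, ⟨hAy.trans hyt, ?_⟩, y, hyt, hAy.le, hlt⟩
    rw [hBdef]; dsimp only; linarith
  · intro n
    have hAB : A n < B n := (hA1 n).trans_lt (hB1 n)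
    exact hC v s hv hs hvs (A n) (B n) (B n + 1) hAB (lt_add_one _)
      (fun a b c h1 h2 h3 _ => hA a b c ((hApos n).le.trans h1) h2 h3)
      (hvfin _ _ (hApos n) (by linarith)) (hsfin _ _ (hApos n).le (by linarith)) g hg l hl

/-! ### Rearrangement of the maximal functions -/

theorem rearrangement_antitone (μ : Measure ℝ) (g : ℝ → ℝ≥0∞) : Antitone (rearrangement μ g) :=
  fun _ _ hst => sInf_le_sInf fun _ hl => le_trans hl (ENNReal.ofReal_le_ofReal hst)

/-- The infimum defining the rearrangement is attained, because distribution functions are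
continuous from the right. -/
theorem measure_rearrangement_lt_le (μ : Measure ℝ) (g : ℝ → ℝ≥0∞) (t : ℝ) :
    μ {s | rearrangement μ g t < g s} ≤ ENNReal.ofReal t := by
  set Z : Set ℝ≥0∞ := {l | μ {s | l < g s} ≤ ENNReal.ofReal t} with hZ
  have hne : Z.Nonempty := ⟨∞, by simp [hZ]⟩
  obtain ⟨u, hu, hut, huZ⟩ := exists_seq_tendsto_sInf hne (OrderBot.bddBelow Z)
  have hU : {s | rearrangement μ g t < g s} ⊆ ⋃ n, {s | u n < g s} := by
    intro s hs
    have hs' : sInf Z < g s := hs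
    obtain ⟨n, hn⟩ := (hut.eventually_lt_const hs').exists
    exact mem_iUnion.2 ⟨n, hn⟩
  have hmono : Monotone fun n => {s | u n < g s} := fun m n hmn s (hs : u m < g s) =>
    lt_of_le_of_lt (hu hmn) hs
  calc _ ≤ μ (⋃ n, {s | u n < g s}) := measure_mono hU
    _ = ⨆ n, μ {s | u n < g s} := hmono.measure_iUnion
    _ ≤ _ := iSup_le fun n => huZ n

theorem tsum_rpow_le_rpow_tsum {r : ℝ} (hr : 1 ≤ r) (x : ℕ → ℝ≥0∞) :
    ∑' n, x n ^ r ≤ (∑' n, x n) ^ r := by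
  have hr0 : 0 < r := by linarith
  have h : ∀ n : ℕ, ∑ i ∈ Finset.range n, x i ^ r ≤ (∑ i ∈ Finset.range n, x i) ^ r := by
    intro n
    induction n with
    | zero => simp
    | succ n ih =>
      rw [Finset.sum_range_succ, Finset.sum_range_succ]
      exact (add_le_add ih le_rfl).trans (ENNReal.add_rpow_le_rpow_add _ _ hr)
  rw [ENNReal.tsum_eq_iSup_nat]
  exact iSup_le fun n => (h n).trans (ENNReal.rpow_le_rpow (ENNReal.sum_le_tsum _) hr0.le)

/-- Slice at the increasing levels `a n = g*(t / τ ^ n)`: where `a n < g ≤ a (n + 1)`, a set of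
measure at most `t / τ ^ n`, the integrand is at most `a (n + 1) ^ r`. Points above all levels form
a null set. -/
theorem lintegral_indicator_rpow_le (μ : Measure ℝ) {g : ℝ → ℝ≥0∞} (hg : Measurable g) {r : ℝ}
    (hr : 0 < r) {τ : ℝ} (hτ : 1 < τ) (t : ℝ) :
    ∫⁻ x, ({x | rearrangement μ g t < g x}.indicator g x) ^ r ∂μ ≤
      ∑' n : ℕ, rearrangement μ g (t / τ ^ (n + 1)) ^ r * ENNReal.ofReal (t / τ ^ n) := by
  set a : ℕ → ℝ≥0∞ := fun n => rearrangement μ g (t / τ ^ n) with ha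
  have ha0 : rearrangement μ g t = a 0 := by simp [ha]
  have hma : ∀ n, MeasurableSet {x | a n < g x} := fun n => measurableSet_lt measurable_const hg
  have hμa : ∀ n, μ {x | a n < g x} ≤ ENNReal.ofReal (t / τ ^ n) := fun n =>
    measure_rearrangement_lt_le μ g _
  have hnull : ∀ᵐ x ∂μ, ∃ n, g x ≤ a n := by
    have hlim : Filter.Tendsto (fun n : ℕ => ENNReal.ofReal (t / τ ^ n)) Filter.atTop (nhds 0) := by
      rw [← ENNReal.ofReal_zero]
      refine ENNReal.tendsto_ofReal ?_
      have := (tendsto_pow_atTop_nhds_zero_of_lt_one (r := τ⁻¹) (by positivity)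
        (inv_lt_one_of_one_lt₀ hτ)).const_mul t
      simpa [div_eq_mul_inv] using this
    rw [ae_iff]
    refine le_antisymm (ge_of_tendsto' hlim fun n => (measure_mono ?_).trans (hμa n)) zero_le
    intro x (hx : ¬∃ n, g x ≤ a n)
    push Not at hx
    exact hx n
  calc _ ≤ ∫⁻ x, ∑' n : ℕ, {x | a n < g x}.indicator (fun _ => a (n + 1) ^ r) x ∂μ := by
        refine lintegral_mono_ae ?_
        filter_upwards [hnull] with x hx
        rw [ha0]
        by_cases h0 : a 0 < g x
        · classical
          have hk := Nat.find_spec hx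
          have hk0 : Nat.find hx ≠ 0 := fun h => absurd (h ▸ hk) (not_le.2 h0)
          obtain ⟨j, hj⟩ := Nat.exists_eq_succ_of_ne_zero hk0
          have hlt : a j < g x := not_le.1 (Nat.find_min hx (by omega))
          rw [hj] at hk
          refine le_trans ?_ (ENNReal.le_tsum j)
          rw [indicator_of_mem (s := {x | a 0 < g x}) h0,
            indicator_of_mem (s := {x | a j < g x}) hlt]
          exact ENNReal.rpow_le_rpow hk hr.le
        · rw [indicator_of_notMem (s := {x | a 0 < g x}) h0, ENNReal.zero_rpow_of_pos hr]
          exact zero_le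
    _ = ∑' n : ℕ, a (n + 1) ^ r * μ {x | a n < g x} := by
        rw [lintegral_tsum fun n => (measurable_const.indicator (hma n)).aemeasurable]
        congr 1; ext n
        rw [lintegral_indicator_const (hma n)]
    _ ≤ _ := ENNReal.tsum_le_tsum fun n => mul_le_mul_right (hμa n) _

/-- A weak type `(r, r)` operator which is bounded on `L^∞` is controlled, after rearrangement, by
a sum of dilations. -/
theorem rearrangement_le_of_weakType (μ : Measure ℝ) (M : (ℝ → ℝ≥0∞) → ℝ → ℝ≥0∞) {r : ℝ}
    (hr : 1 < r) (C : ℝ≥0)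
    (hweak : ∀ g : ℝ → ℝ≥0∞, Measurable g → ∀ l : ℝ, 0 < l →
      ENNReal.ofReal l ^ r * μ {t | ENNReal.ofReal l < M g t} ≤ C * ∫⁻ x, g x ^ r ∂μ)
    (htrunc : ∀ g : ℝ → ℝ≥0∞, Measurable g → ∀ (a : ℝ≥0∞) (t : ℝ),
      M g t ≤ a + M ({x | a < g x}.indicator g) t)
    {τ : ℝ} (hτ : 1 < τ) {g : ℝ → ℝ≥0∞} (hg : Measurable g) {t : ℝ} (ht : 0 < t) :
    rearrangement μ (M g) t ≤ rearrangement μ g t + (C : ℝ≥0∞) ^ (1 / r) *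
      ∑' n : ℕ, ENNReal.ofReal (τ⁻¹ ^ (1 / r)) ^ n * rearrangement μ g (t / τ ^ (n + 1)) := by
  have hr0 : 0 < r := by linarith
  have hτ0 : 0 < τ := by linarith
  set a := rearrangement μ g t with ha
  set q := ENNReal.ofReal (τ⁻¹ ^ (1 / r)) with hq
  set b : ℕ → ℝ≥0∞ := fun n => rearrangement μ g (t / τ ^ (n + 1)) with hb
  have hqr : q ^ r = ENNReal.ofReal τ⁻¹ := by
    rw [hq, ENNReal.ofReal_rpow_of_pos (by positivity), ← Real.rpow_mul (by positivity),
      one_div_mul_cancel hr0.ne', Real.rpow_one]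
  set g₁ := {x | a < g x}.indicator g with hg₁
  have hg₁m : Measurable g₁ := hg.indicator (measurableSet_lt measurable_const hg)
  set E := (C : ℝ≥0∞) ^ (1 / r) * ∑' n, q ^ n * b n with hE
  -- As `q ^ r = τ⁻¹`, the sliced integral is `t` times the sum of the `(q ^ n * b n) ^ r`, and the
  -- `ℓ^r` norm is at most the `ℓ^1` norm. Turning it into a sum of first powers allows the triangle
  -- inequality in `E`.
  have hCI : (C : ℝ≥0∞) * ∫⁻ x, g₁ x ^ r ∂μ ≤ ENNReal.ofReal t * E ^ r := by
    calc (C : ℝ≥0∞) * ∫⁻ x, g₁ x ^ r ∂μ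
        ≤ C * ∑' n : ℕ, b n ^ r * ENNReal.ofReal (t / τ ^ n) :=
          mul_le_mul_right (lintegral_indicator_rpow_le μ hg hr0 hτ t) _
      _ = C * (ENNReal.ofReal t * ∑' n : ℕ, (q ^ n * b n) ^ r) := by
          rw [← ENNReal.tsum_mul_left (a := ENNReal.ofReal t)]
          refine congrArg (fun y => (C : ℝ≥0∞) * y) (tsum_congr fun n => ?_)
          rw [ENNReal.mul_rpow_of_nonneg _ _ hr0.le, ← ENNReal.rpow_natCast, ← ENNReal.rpow_mul,
            mul_comm (n : ℝ) r, ENNReal.rpow_mul, hqr, ENNReal.rpow_natCast,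
            ← ENNReal.ofReal_pow (by positivity), ← mul_assoc, ← ENNReal.ofReal_mul ht.le,
            inv_pow, ← div_eq_mul_inv, mul_comm]
      _ ≤ C * (ENNReal.ofReal t * (∑' n : ℕ, q ^ n * b n) ^ r) := by
          gcongr; exact tsum_rpow_le_rpow_tsum hr.le _
      _ = _ := by
          rw [hE, ENNReal.mul_rpow_of_nonneg _ _ hr0.le, ← ENNReal.rpow_mul,
            one_div_mul_cancel hr0.ne', ENNReal.rpow_one]
          ring
  -- Truncation puts `{M g > a + l}` inside `{M g₁ > l}`, whose measure is at most `t * (E / l) ^ r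
  -- ≤ t` by the weak type inequality.
  have hlevel : ∀ l : ℝ≥0, E < l → rearrangement μ (M g) t ≤ a + l := by
    intro l hEl
    have hl0 : (0 : ℝ) < l := by
      have : (0 : ℝ≥0∞) < l := lt_of_le_of_lt zero_le hEl
      exact_mod_cast this
    refine sInf_le ?_
    change μ {s | a + l < M g s} ≤ ENNReal.ofReal t
    rcases eq_or_ne a ∞ with hat | hat
    · simp [hat]
    have hsub : {s | a + l < M g s} ⊆ {s | ENNReal.ofReal l < M g₁ s} := by
      intro s (hs : a + l < M g s)
      have := hs.trans_le (htrunc g hg a s)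
      rw [ENNReal.add_lt_add_iff_left hat] at this
      simpa using this
    refine (measure_mono hsub).trans ?_
    have hl1 : ENNReal.ofReal l ^ r ≠ 0 := by
      rw [Ne, ENNReal.rpow_eq_zero_iff_of_pos hr0]; simpa [pos_iff_ne_zero] using hl0
    have hl2 : ENNReal.ofReal l ^ r ≠ ∞ :=
      ENNReal.rpow_ne_top_of_nonneg hr0.le ENNReal.ofReal_ne_top
    refine (ENNReal.mul_le_mul_iff_right hl1 hl2).1 ?_
    calc _ ≤ _ := hweak g₁ hg₁m l hl0
      _ ≤ _ := hCI
      _ ≤ ENNReal.ofReal t * ENNReal.ofReal l ^ r := by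
          gcongr
          simpa using hEl.le
      _ = _ := mul_comm _ _
  rcases eq_or_ne E ∞ with hEt | hEt
  · rw [hEt]; simp
  · refine ENNReal.le_of_forall_pos_le_add fun ε hε _ => ?_
    have h1 : E < ((E.toNNReal + ε : ℝ≥0) : ℝ≥0∞) := by
      push_cast
      rw [ENNReal.coe_toNNReal hEt]
      exact ENNReal.lt_add_right hEt (by exact_mod_cast hε.ne')
    have h2 := hlevel _ h1
    push_cast at h2
    rwa [ENNReal.coe_toNNReal hEt, ← add_assoc] at h2

/-! ### Norm estimates -/

namespace RIBanachFunctionNorm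

variable (E : RIBanachFunctionNorm)

theorem ρ_zero : E.ρ (fun _ => 0) = 0 :=
  (E.eq_zero_iff _ measurable_const).2 (Filter.Eventually.of_forall fun _ => rfl)

theorem ρ_const_mul {k : ℝ≥0∞} (hk : k ≠ ∞) {f : ℝ → ℝ≥0∞} (hf : Measurable f) :
    E.ρ (fun s => k * f s) = k * E.ρ f := by
  lift k to ℝ≥0 using hk
  exact E.smul k f hf

theorem ρ_tsum_le {F : ℕ → ℝ → ℝ≥0∞} (hF : ∀ n, Measurable (F n)) :
    E.ρ (fun s => ∑' n, F n s) ≤ ∑' n, E.ρ (F n) := by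
  have hsum : ∀ n : ℕ, E.ρ (fun s => ∑ i ∈ Finset.range n, F i s) ≤
      ∑ i ∈ Finset.range n, E.ρ (F i) := by
    intro n
    induction n with
    | zero => simp [E.ρ_zero]
    | succ n ih =>
      simp only [Finset.sum_range_succ]
      refine (E.add_le _ _ (Finset.measurable_sum _ fun i _ => hF i) (hF n)).trans ?_
      gcongr
  simp only [ENNReal.tsum_eq_iSup_nat]
  rw [E.fatou (fun n s => ∑ i ∈ Finset.range n, F i s)
    (fun n => Finset.measurable_sum _ fun i _ => hF i)]
  · exact iSup_mono hsum
  · intro m n hmn s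
    exact Finset.sum_le_sum_of_subset (Finset.range_mono hmn)

theorem ρ_dilation_le {τ : ℝ} (hh : E.dilationNorm τ ≠ ∞) {f : ℝ → ℝ≥0∞} (hf : Measurable f)
    (hfin : E.ρ f ≠ ∞) : E.ρ (fun s => f (s / τ)) ≤ E.dilationNorm τ * E.ρ f := by
  have key : ∀ k : ℝ≥0∞, k ≠ ∞ → k * E.ρ f ≤ 1 →
      k * E.ρ (fun s => f (s / τ)) ≤ E.dilationNorm τ := by
    intro k hkt hk
    have hfd : Measurable fun s => f (s / τ) := hf.comp (measurable_id.div_const τ)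
    rw [← E.ρ_const_mul hkt hfd]
    rw [← E.ρ_const_mul hkt hf] at hk
    exact le_iSup_of_le (fun s => k * f s) <| le_iSup_of_le (hf.const_mul k) <|
      le_iSup_of_le hk le_rfl
  -- Normalisation is impossible when the norm is `0`. In that case all multiples of `f` lie in the
  -- unit ball, and finiteness of the dilation norm forces the dilate to have norm `0`.
  rcases eq_or_ne (E.ρ f) 0 with h0 | h0
  · have h2 : E.ρ (fun s => f (s / τ)) = 0 := by
      by_contra hne
      obtain ⟨n, hn⟩ := ENNReal.exists_nat_mul_gt hne hh
      exact absurd (key n (ENNReal.natCast_ne_top n) (by simp [h0])) (not_le.2 hn)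
    rw [h2]; exact zero_le
  · have h1 := key (E.ρ f)⁻¹ (ENNReal.inv_ne_top.2 h0) (ENNReal.inv_mul_cancel h0 hfin).le
    calc _ = E.ρ f * ((E.ρ f)⁻¹ * E.ρ (fun s => f (s / τ))) := by
          rw [← mul_assoc, ENNReal.mul_inv_cancel h0 hfin, one_mul]
      _ ≤ E.ρ f * E.dilationNorm τ := by gcongr
      _ = _ := mul_comm _ _

theorem ρ_dilation_pow_le {τ : ℝ} (hh : E.dilationNorm τ ≠ ∞) {f : ℝ → ℝ≥0∞} (hf : Measurable f)
    (hfin : E.ρ f ≠ ∞) (n : ℕ) :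
    E.ρ (fun s => f (s / τ ^ n)) ≤ E.dilationNorm τ ^ n * E.ρ f := by
  induction n with
  | zero => simp
  | succ n ih =>
    have hfin' : E.ρ (fun s => f (s / τ ^ n)) ≠ ∞ :=
      ne_top_of_le_ne_top (ENNReal.mul_ne_top (ENNReal.pow_ne_top hh) hfin) ih
    have h := E.ρ_dilation_le hh (hf.comp (measurable_id.div_const (τ ^ n))) hfin'
    have e : ∀ s : ℝ, s / τ / τ ^ n = s / τ ^ (n + 1) := fun s => by rw [div_div, pow_succ']
    simp only [Function.comp_def, id, e] at h
    calc _ ≤ _ := h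
      _ ≤ E.dilationNorm τ * (E.dilationNorm τ ^ n * E.ρ f) := by gcongr
      _ = _ := by ring

/-- An exponent below the lower Boyd index gives a dilation with small norm. -/
theorem exists_dilationNorm_lt {r : ℝ} (hr : 0 < r) (h : ENNReal.ofReal r < E.lowerBoyd) :
    ∃ τ : ℝ, 1 < τ ∧ E.dilationNorm τ < ENNReal.ofReal (τ ^ (1 / r)) := by
  simp only [lowerBoyd, lt_iSup_iff, mem_Ioi] at h
  obtain ⟨τ, hτ, hlt⟩ := h
  refine ⟨τ, hτ, ?_⟩
  have hτ0 : 0 < τ := by linarith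
  rw [ENNReal.lt_div_iff_mul_lt (Or.inr ENNReal.ofReal_ne_top) (Or.inr (by simpa using hr))] at hlt
  by_contra! hle
  refine absurd hlt (not_lt.2 ?_)
  have h1 := ENNReal.log_le_log hle
  rw [ENNReal.log_ofReal_of_pos (by positivity), Real.log_rpow hτ0] at h1
  have h2 := EReal.toENNReal_le_toENNReal h1
  have h3 : EReal.toENNReal ((1 / r * Real.log τ : ℝ) : EReal) =
      ENNReal.ofReal (1 / r * Real.log τ) := by
    rw [EReal.toENNReal_of_ne_top (EReal.coe_ne_top _), EReal.toReal_coe]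
  rw [h3] at h2
  calc ENNReal.ofReal (Real.log τ) = ENNReal.ofReal r * ENNReal.ofReal (1 / r * Real.log τ) := by
        rw [← ENNReal.ofReal_mul hr.le]; congr 1; field_simp
    _ ≤ _ := by gcongr

/-- An operator of weak type `(r, r)`, with `r` below the lower Boyd index, which is bounded on
`L^∞`, is bounded in the norm of rearrangements. -/
theorem exists_bound_of_weakType (μ : Measure ℝ) (M : (ℝ → ℝ≥0∞) → ℝ → ℝ≥0∞) {r : ℝ}
    (hr : 1 < r) (hrE : ENNReal.ofReal r < E.lowerBoyd) (C : ℝ≥0)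
    (hweak : ∀ g : ℝ → ℝ≥0∞, Measurable g → ∀ l : ℝ, 0 < l →
      ENNReal.ofReal l ^ r * μ {t | ENNReal.ofReal l < M g t} ≤ C * ∫⁻ x, g x ^ r ∂μ)
    (htrunc : ∀ g : ℝ → ℝ≥0∞, Measurable g → ∀ (a : ℝ≥0∞) (t : ℝ),
      M g t ≤ a + M ({x | a < g x}.indicator g) t) :
    ∃ C' : ℝ≥0, ∀ g : ℝ → ℝ≥0∞, Measurable g → E.ρ (rearrangement μ g) < ∞ →
      E.ρ (rearrangement μ (M g)) ≤ C' * E.ρ (rearrangement μ g) := by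
  have hr0 : 0 < r := by linarith
  obtain ⟨τ, hτ, hlt⟩ := E.exists_dilationNorm_lt hr0 hrE
  have hτ0 : 0 < τ := by linarith
  set h := E.dilationNorm τ with hh
  have hht : h ≠ ∞ := hlt.ne_top
  set q := ENNReal.ofReal (τ⁻¹ ^ (1 / r)) with hq
  have hq0 : q ≠ 0 := by
    have : 0 < τ⁻¹ ^ (1 / r) := by positivity
    simpa [hq] using this
  -- Since `q = τ ^ (-1 / r)` and `h < τ ^ (1 / r)`, the geometric series of dilation norms
  -- converges.
  have hqh : q * h < 1 := by
    have h1 : q * ENNReal.ofReal (τ ^ (1 / r)) = 1 := by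
      rw [hq, ← ENNReal.ofReal_mul (by positivity), ← Real.mul_rpow (by positivity) hτ0.le,
        inv_mul_cancel₀ hτ0.ne', Real.one_rpow, ENNReal.ofReal_one]
    rw [← h1]
    exact (ENNReal.mul_lt_mul_iff_right hq0 ENNReal.ofReal_ne_top).2 hlt
  set D : ℝ≥0∞ := 1 + (C : ℝ≥0∞) ^ (1 / r) * (h * (1 - q * h)⁻¹) with hD
  have hDt : D ≠ ∞ := by
    refine ENNReal.add_ne_top.2 ⟨ENNReal.one_ne_top, ENNReal.mul_ne_top
      (ENNReal.rpow_ne_top_of_nonneg (by positivity) ENNReal.coe_ne_top)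
      (ENNReal.mul_ne_top hht (ENNReal.inv_ne_top.2 (tsub_pos_of_lt hqh).ne'))⟩
  refine ⟨D.toNNReal, fun g hg hgfin => ?_⟩
  rw [ENNReal.coe_toNNReal hDt]
  have hm : ∀ f, Measurable (rearrangement μ f) := fun f => (rearrangement_antitone μ f).measurable
  have hmd : ∀ n : ℕ, Measurable fun s => rearrangement μ g (s / τ ^ n) := fun n =>
    (hm g).comp (measurable_id.div_const _)
  have hmt : Measurable fun s => ∑' n : ℕ, q ^ n * rearrangement μ g (s / τ ^ (n + 1)) :=
    Measurable.tsum fun n => (hmd (n + 1)).const_mul _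
  calc E.ρ (rearrangement μ (M g))
      ≤ E.ρ fun s => rearrangement μ g s + (C : ℝ≥0∞) ^ (1 / r) *
          ∑' n : ℕ, q ^ n * rearrangement μ g (s / τ ^ (n + 1)) := by
        refine E.mono _ _ (hm _) ((hm g).add (hmt.const_mul _)) ?_
        rw [vol]
        filter_upwards [ae_restrict_mem measurableSet_Ioi] with t ht
        exact rearrangement_le_of_weakType μ M hr C hweak htrunc hτ hg ht
    _ ≤ E.ρ (rearrangement μ g) + (C : ℝ≥0∞) ^ (1 / r) *
          ∑' n : ℕ, q ^ n * (h ^ (n + 1) * E.ρ (rearrangement μ g)) := by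
        refine (E.add_le _ _ (hm g) (hmt.const_mul _)).trans ?_
        rw [E.ρ_const_mul (ENNReal.rpow_ne_top_of_nonneg (by positivity) ENNReal.coe_ne_top) hmt]
        gcongr
        refine (E.ρ_tsum_le fun n => (hmd (n + 1)).const_mul _).trans
          (ENNReal.tsum_le_tsum fun n => ?_)
        rw [E.ρ_const_mul (ENNReal.pow_ne_top ENNReal.ofReal_ne_top) (hmd (n + 1))]
        gcongr
        exact E.ρ_dilation_pow_le hht (hm g) hgfin.ne (n + 1)
    _ = D * E.ρ (rearrangement μ g) := by
        have e : ∀ n : ℕ, q ^ n * (h ^ (n + 1) * E.ρ (rearrangement μ g)) =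
            (h * E.ρ (rearrangement μ g)) * (q * h) ^ n := fun n => by rw [mul_pow]; ring
        simp only [e]
        rw [ENNReal.tsum_mul_left, ENNReal.tsum_geometric, hD]
        ring

end RIBanachFunctionNorm

/-! ### Truncation and measurability of the maximal functions -/

/-- Pointwise `g ≤ a + g 1_{g > a}`, and the mean of the constant `a` is `a`. Stated for a general
interval, it serves both maximal functions. -/
theorem setLIntegral_div_le_add (g : ℝ → ℝ≥0∞) (a : ℝ≥0∞) {x y h : ℝ}
    (hxy : y - x = h) (hh : 0 < h) :
    (∫⁻ s in Ioo x y, (Ioi 0).indicator g s) / ENNReal.ofReal h ≤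
      a + (∫⁻ s in Ioo x y, (Ioi 0).indicator ({x | a < g x}.indicator g) s) /
        ENNReal.ofReal h := by
  have h0 : ENNReal.ofReal h ≠ 0 := by simpa using hh
  calc _ ≤ (∫⁻ s in Ioo x y, (a + (Ioi 0).indicator ({x | a < g x}.indicator g) s)) /
        ENNReal.ofReal h := by
        gcongr with s
        by_cases hs : s ∈ Ioi (0 : ℝ)
        · rw [indicator_of_mem hs, indicator_of_mem hs]
          by_cases hgs : a < g s
          · rw [indicator_of_mem (s := {x | a < g x}) hgs]
            exact le_add_self
          · exact (not_lt.1 hgs).trans le_self_add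
        · rw [indicator_of_notMem hs]; exact zero_le
    _ = _ := by
        rw [lintegral_add_left measurable_const, setLIntegral_const, Real.volume_Ioo, hxy,
          ENNReal.add_div, ENNReal.mul_div_cancel_right h0 ENNReal.ofReal_ne_top]

theorem maxRight_le_add (g : ℝ → ℝ≥0∞) (a : ℝ≥0∞) (t : ℝ) :
    maxRight g t ≤ a + maxRight ({x | a < g x}.indicator g) t := by
  by_cases ht : t ∈ Ioi (0 : ℝ)
  · rw [maxRight, maxRight, indicator_of_mem ht, indicator_of_mem ht]
    refine iSup₂_le fun h hh => ?_
    refine (setLIntegral_div_le_add g a (by ring) hh).trans ?_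
    gcongr
    exact le_iSup₂_of_le h hh le_rfl
  · rw [maxRight, indicator_of_notMem ht]; exact zero_le

theorem maxLeft_le_add (g : ℝ → ℝ≥0∞) (a : ℝ≥0∞) (t : ℝ) :
    maxLeft g t ≤ a + maxLeft ({x | a < g x}.indicator g) t := by
  by_cases ht : t ∈ Ioi (0 : ℝ)
  · rw [maxLeft, maxLeft, indicator_of_mem ht, indicator_of_mem ht]
    refine iSup₂_le fun h hh => ?_
    refine (setLIntegral_div_le_add g a (by ring) hh).trans ?_
    gcongr
    exact le_iSup₂_of_le h hh le_rfl
  · rw [maxLeft, indicator_of_notMem ht]; exact zero_le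

/-- A strict lower bound for the measure persists on a slightly shrunken interval, which stays
inside the window under small translations. Suprema over uncountably many window lengths are
therefore measurable. -/
theorem lowerSemicontinuous_measure_Ioo_div (m : Measure ℝ) (u v : ℝ) (c : ℝ) (hc : 0 < c) :
    LowerSemicontinuous fun t => m (Ioo (t + u) (t + v)) / ENNReal.ofReal c := by
  have hc0 : ENNReal.ofReal c ≠ 0 := by simpa using hc
  intro t k hk
  change k < m (Ioo (t + u) (t + v)) / ENNReal.ofReal c at hk
  rw [ENNReal.lt_div_iff_mul_lt (Or.inl hc0) (Or.inl ENNReal.ofReal_ne_top)] at hk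
  have hU : Ioo (t + u) (t + v) ⊆
      ⋃ n : ℕ, Ioo (t + u + 1 / ((n : ℝ) + 1)) (t + v - 1 / ((n : ℝ) + 1)) := by
    intro x hx
    obtain ⟨n, hn⟩ := exists_nat_one_div_lt
      (lt_min (sub_pos.2 hx.1) (sub_pos.2 hx.2))
    exact mem_iUnion.2 ⟨n, by linarith [hn.trans_le (min_le_left _ _)],
      by linarith [hn.trans_le (min_le_right _ _)]⟩
  have hmono : Monotone fun n : ℕ =>
      Ioo (t + u + 1 / ((n : ℝ) + 1)) (t + v - 1 / ((n : ℝ) + 1)) := by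
    intro i j hij
    have : 1 / ((j : ℝ) + 1) ≤ 1 / ((i : ℝ) + 1) := Nat.one_div_le_one_div hij
    exact Ioo_subset_Ioo (by linarith) (by linarith)
  have hk' := hk.trans_le (measure_mono hU)
  rw [hmono.measure_iUnion, lt_iSup_iff] at hk'
  obtain ⟨n, hn⟩ := hk'
  filter_upwards [Metric.ball_mem_nhds t (Nat.one_div_pos_of_nat (α := ℝ) (n := n))] with t' ht'
  change k < m (Ioo (t' + u) (t' + v)) / ENNReal.ofReal c
  rw [ENNReal.lt_div_iff_mul_lt (Or.inl hc0) (Or.inl ENNReal.ofReal_ne_top)]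
  refine hn.trans_le (measure_mono ?_)
  rw [Metric.mem_ball, Real.dist_eq, abs_lt] at ht'
  exact Ioo_subset_Ioo (by linarith [ht'.2]) (by linarith [ht'.1])

theorem measurable_maxRight (g : ℝ → ℝ≥0∞) : Measurable (maxRight g) := by
  refine Measurable.indicator (LowerSemicontinuous.measurable ?_) measurableSet_Ioi
  refine lowerSemicontinuous_biSup fun h hh => ?_
  have := lowerSemicontinuous_measure_Ioo_div
    (volume.withDensity ((Ioi 0).indicator g)) 0 h h hh
  simpa only [withDensity_apply _ measurableSet_Ioo, add_zero] using this

theorem measurable_maxLeft (g : ℝ → ℝ≥0∞) : Measurable (maxLeft g) := by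
  refine Measurable.indicator (LowerSemicontinuous.measurable ?_) measurableSet_Ioi
  refine lowerSemicontinuous_biSup fun h hh => ?_
  have := lowerSemicontinuous_measure_Ioo_div
    (volume.withDensity ((Ioi 0).indicator g)) (-h) 0 h hh
  simpa only [withDensity_apply _ measurableSet_Ioo, add_zero, ← sub_eq_add_neg] using this

theorem setLIntegral_enorm_indicator {f : ℝ → ℝ} {g : ℝ → ℝ≥0∞} (h : (fun s => ‖f s‖ₑ) =ᵐ[vol] g)
    (T : Set ℝ) :
    ∫⁻ s in T, ‖(Ioi (0 : ℝ)).indicator f s‖ₑ = ∫⁻ s in T, (Ioi 0).indicator g s := by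
  refine lintegral_congr_ae (ae_restrict_of_ae ?_)
  rw [vol, Filter.EventuallyEq, ae_restrict_iff' measurableSet_Ioi] at h
  filter_upwards [h] with s hs
  by_cases h0 : s ∈ Ioi (0 : ℝ)
  · rw [indicator_of_mem h0, indicator_of_mem h0, hs h0]
  · rw [indicator_of_notMem h0, indicator_of_notMem h0, enorm_zero]

theorem halfMaxPlus_eq {f : ℝ → ℝ} {g : ℝ → ℝ≥0∞} (h : (fun s => ‖f s‖ₑ) =ᵐ[vol] g) :
    halfMaxPlus f = maxRight g := by
  unfold halfMaxPlus maxRight maxPlus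
  simp only [setLIntegral_enorm_indicator h]

theorem halfMaxMinus_eq {f : ℝ → ℝ} {g : ℝ → ℝ≥0∞} (h : (fun s => ‖f s‖ₑ) =ᵐ[vol] g) :
    halfMaxMinus f = maxLeft g := by
  unfold halfMaxMinus maxLeft maxMinus
  simp only [setLIntegral_enorm_indicator h]

theorem rearrangement_weightMeasure_congr (w : ℝ → ℝ) {f g : ℝ → ℝ≥0∞} (h : f =ᵐ[vol] g) :
    rearrangement (weightMeasure w) f = rearrangement (weightMeasure w) g := by
  have hac : weightMeasure w ≪ vol := withDensity_absolutelyContinuous _ _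
  have h' : f =ᵐ[weightMeasure w] g := hac.ae_eq h
  ext t
  unfold rearrangement
  congr 1
  ext l
  simp only [mem_ofPred_eq]
  rw [measure_congr (μ := weightMeasure w) (s := {s | l < f s}) (t := {s | l < g s})]
  filter_upwards [h'] with s hs
  exact congrArg (fun y => l < y) hs

/-- Boundedness on `E_w` follows from a weak type inequality below the lower Boyd index. -/
theorem RIBanachFunctionNorm.boundedOnWeighted_of_weakType (E : RIBanachFunctionNorm) (w : ℝ → ℝ)
    (T : (ℝ → ℝ) → ℝ → ℝ≥0∞) (M : (ℝ → ℝ≥0∞) → ℝ → ℝ≥0∞)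
    (hT : ∀ (f : ℝ → ℝ) (g : ℝ → ℝ≥0∞), (fun s => ‖f s‖ₑ) =ᵐ[vol] g → T f = M g)
    (hM : ∀ g, Measurable (M g))
    (htrunc : ∀ g : ℝ → ℝ≥0∞, Measurable g → ∀ (a : ℝ≥0∞) (t : ℝ),
      M g t ≤ a + M ({x | a < g x}.indicator g) t)
    (hE : E.lowerBoyd < ∞)
    (hweak : ∃ r : ℝ, 1 < r ∧ r < E.lowerBoyd.toReal ∧ ∃ C : ℝ≥0, ∀ g : ℝ → ℝ≥0∞, Measurable g →
      ∀ l : ℝ, 0 < l → ENNReal.ofReal l ^ r * weightMeasure w {t | ENNReal.ofReal l < M g t} ≤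
        C * ∫⁻ x, g x ^ r ∂(weightMeasure w)) :
    E.BoundedOnWeighted w T := by
  obtain ⟨r, hr1, hrp, C, hC⟩ := hweak
  obtain ⟨C', hC'⟩ := E.exists_bound_of_weakType (weightMeasure w) M hr1
    ((ENNReal.ofReal_lt_iff_lt_toReal (by linarith) hE.ne).2 hrp) C hC htrunc
  refine ⟨C', fun f hf hfE => ?_⟩
  obtain ⟨g, hg, hfg⟩ := hf.enorm
  have hnorm : E.weightedNorm w (fun s => ‖f s‖ₑ) = E.ρ (rearrangement (weightMeasure w) g) := by
    rw [weightedNorm, rearrangement_weightMeasure_congr w hfg]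
  have hfin := hfE.2
  rw [hnorm] at hfin ⊢
  have hle := hC' g hg hfin
  rw [hT f g hfg]
  exact ⟨⟨(hM g).aemeasurable, hle.trans_lt (ENNReal.mul_lt_top ENNReal.coe_lt_top hfin)⟩, hle⟩

end HalfLine

theorem mainTheorem6 (E : HalfLine.RIBanachFunctionNorm)
    (hp : 1 < E.lowerBoyd) (hp' : E.lowerBoyd < ∞)
    (hq : 1 < E.upperBoyd) (hq' : E.upperBoyd < ∞) (w : ℝ → ℝ) :
    (HalfLine.MemApPlus E.lowerBoyd.toReal w →
      E.BoundedOnWeighted w HalfLine.halfMaxPlus) ∧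
    (HalfLine.MemApMinus E.lowerBoyd.toReal w →
      E.BoundedOnWeighted w HalfLine.halfMaxMinus) := by
  have hp1 : 1 < E.lowerBoyd.toReal := by
    rw [← ENNReal.toReal_one]
    exact (ENNReal.toReal_lt_toReal ENNReal.one_ne_top hp'.ne).2 hp
  exact ⟨fun hw => E.boundedOnWeighted_of_weakType w _ HalfLine.maxRight
      (fun _ _ => HalfLine.halfMaxPlus_eq) HalfLine.measurable_maxRight
      (fun g _ => HalfLine.maxRight_le_add g) hp' (hw.exists_weakType hp1),
    fun hw => E.boundedOnWeighted_of_weakType w _ HalfLine.maxLeft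
      (fun _ _ => HalfLine.halfMaxMinus_eq) HalfLine.measurable_maxLeft
      (fun g _ => HalfLine.maxLeft_le_add g) hp' (hw.exists_weakType hp1)⟩
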